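/- Let $\mathbf{k}$ be a field of characteristic zero and let $q\in\mathbf{k}$ be such that $q^n\neq 1$ for all $n\ge 1$, or $q=1$. **Notation.** Put $[n]_q=1+q+\dots+q^{n-1}$, $[n]_q!=\prod_{i=1}^n[i]_q$ and $(t;q)_n=\prod_{i=1}^n(1-tq^{i-1})$. *Klyachko algebras.* Let $\mathcal K$ be the commutative $\mathbf{k}$-algebra generated by $u_i$ ($i\in\mathbb Z$) with relations $(q+1)u_i^2=q\,u_iu_{i-1}+u_iu_{i+1}$ for all $i\in\mathbb Z$. Let $\mathcal K_+$ be its quotient by the ideal generated by the $u_i$ with $i\le 0$, and let $\mathcal K_n$ be its quotient by the ideal generated by the $u_i$ with $i\le 0$ or $i\ge n$. Let $\rho_+:\mathbf{k}[x_1,x_2,\dots]\to\mathcal K_+$ and $\rho_n:\mathbf{k}[x_1,\dots,x_n]\to\mathcal K_n$ be the $\mathbf{k}$-algebra morphisms with $x_i\mapsto u_i-u_{i-1}$; thus $\rho_n(f)=f(u_1,u_2-u_1,\dots,u_{n-1}-u_{n-2},-u_{n-1})$. For a finite set $I$ of integers let $u_I=\prod_{i\in I}u_i$. *$q$-divided symmetrization.*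 For $f\in\mathbf{k}[x_1,\dots,x_n]$ let $$\langle f\rangle_n^q=\partial_{w_o}\left(\prod_{1\le i<j\le n}(qx_i-x_j)\cdot\frac{f}{\prod_{1\le i\le n-1}(qx_i-x_{i+1})}\right),\qquad \partial_{w_o}(g)=\frac{\sum_{w\in S_n}\mathrm{sgn}(w)\,w(g)}{\prod_{1\le i<j\le n}(x_i-x_j)},$$ where $S_n$ permutes the variables of rational functions in $x_1,\dots,x_n$. *Quasisymmetric functions.* A quasisymmetric function over $\mathbf{k}$ is a power series of bounded degree in $x_1,x_2,\dots$ such that, for all positive integers $\alpha_1,\dots,\alpha_l$, the coefficient of $x_{i_1}^{\alpha_1}\cdots x_{i_l}^{\alpha_l}$ is the same for all $i_1<\dots<i_l$; quasisymmetric polynomials in $x_1,\dots,x_n$ are defined by the same condition with $1\le i_1<\dots<i_l\le n$. Write $f(x_1,\dots,x_m)$ for $f$ with $x_i=0$ for all $i>m$. Let $\mathrm{QSym}_n^+\subset\mathbf{k}[x_1,\dots,x_n]$ be the ideal generated by the quasisymmetric polynomials without constant term. For a composition $\alpha=(\alpha_1,\dots,\alpha_\ell)$ of $r$ with positive parts,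 put $\ell(\alpha)=\ell$, $n(\alpha)=\sum_{i=1}^{\ell}(i-1)\alpha_i$, and $$F_\alpha(x_1,\dots,x_m)=\sum x_{i_1}\cdots x_{i_r},$$ the sum over all $1\le i_1\le\dots\le i_r\le m$ such that $i_j<i_{j+1}$ for every $j\in\{\alpha_1,\alpha_1+\alpha_2,\dots,\alpha_1+\dots+\alpha_{\ell-1}\}$. **Theorem.** Let $r\ge 1$, and let $f$ be a homogeneous quasisymmetric function of degree $r$ over $\mathbf{k}$. 1. For $0\le m\le r+1$ the rational function $\langle f(x_1,\dots,x_m)\rangle_{r+1}^q$ is a constant in $\mathbf{k}$, and in $\mathbf{k}[[t]]$ $$\sum_{j\ge 1}f(1,q,\dots,q^{j-1})\,t^j=\frac{\sum_{m=0}^{r+1}\langle f(x_1,\dots,x_m)\rangle_{r+1}^q\,t^m}{(t;q)_{r+1}}.$$ 2. $f(u_1,u_2-u_1,\dots,u_r-u_{r-1},-u_r)=0$ in $\mathcal K_{r+1}$. 3. $\langle g\rangle_{r+1}^q=0$ for every $g\in\mathrm{QSym}_{r+1}^+$ of degree at most $r$. Moreover: 4. For every composition $\alpha$ of $r$ and every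 $m\ge\ell(\alpha)$, in $\mathcal K_+$, $$\rho_+\bigl(F_\alpha(x_1,\dots,x_m)\bigr)=\frac{q^{n(\alpha)}}{[r]_q!}\;u_{\{1+m-\ell(\alpha),\,\dots,\,r+m-\ell(\alpha)\}}.$$ 5. For every composition $\alpha$ of $r$ and every $m$ with $\ell(\alpha)\le m\le r+1$, $\langle F_\alpha(x_1,\dots,x_m)\rangle_{r+1}^q$ equals $q^{n(\alpha)}$ if $m=\ell(\alpha)$, and $0$ otherwise. 6. For every $n\ge 0$ and every $g\in\mathrm{QSym}_n^+$, $\rho_n(g)=0$ in $\mathcal K_n$. -/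

import Mathlib

noncomputable section

namespace QKlyachko

/-! ### q-integers -/

/-- The `q`-integer `1 + q + ⋯ + q ^ (n - 1)`. -/
def qInt {k : Type*} [Field k] (q : k) (n : ℕ) : k :=
  ∑ i ∈ Finset.range n, q ^ i

/-- The `q`-factorial, the product of the `q`-integers of `1, …, n`. -/
def qFactorial {k : Type*} [Field k] (q : k) (n : ℕ) : k :=
  ∏ i ∈ Finset.range n, qInt q (i + 1)

/-- The `q`-Pochhammer symbol `(t; q)_n = ∏_{1 ≤ i ≤ n} (1 - t q ^ (i - 1))`, as a power series
in the variable `t`. -/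
def qPochhammer {k : Type*} [Field k] (q : k) (n : ℕ) : PowerSeries k :=
  ∏ i ∈ Finset.range n, (1 - PowerSeries.X * PowerSeries.C (q ^ i))

/-! ### Quasisymmetric functions and polynomials

The variables `x_1, x_2, …` are indexed from zero: `x_{i+1}` is the variable with index `i`. -/

/-- A formal power series in `x_1, x_2, …` is a quasisymmetric function if it has bounded degree
and, for all positive exponents `α_1, …, α_l`, the coefficient of
`x_{i_1} ^ α_1 ⋯ x_{i_l} ^ α_l` is the same for all `i_1 < ⋯ < i_l`. -/
structure IsQuasisymmetric {k : Type*} [Field k] (f : MvPowerSeries ℕ k) : Prop where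
  bounded : ∃ d : ℕ, ∀ e : ℕ →₀ ℕ, MvPowerSeries.coeff e f ≠ 0 → e.degree ≤ d
  coeff_eq : ∀ (l : ℕ) (α : Fin l → ℕ), (∀ j, 0 < α j) →
    ∀ i i' : Fin l → ℕ, StrictMono i → StrictMono i' →
      MvPowerSeries.coeff (∑ j, Finsupp.single (i j) (α j)) f =
        MvPowerSeries.coeff (∑ j, Finsupp.single (i' j) (α j)) f

/-- A polynomial in `x_1, …, x_n` is quasisymmetric if, for all positive exponents
`α_1, …, α_l`, the coefficient of `x_{i_1} ^ α_1 ⋯ x_{i_l} ^ α_l` is the same for all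
`i_1 < ⋯ < i_l`. -/
def IsQuasisymmetricPoly {k : Type*} [Field k] {n : ℕ} (p : MvPolynomial (Fin n) k) : Prop :=
  ∀ (l : ℕ) (α : Fin l → ℕ), (∀ j, 0 < α j) →
    ∀ i i' : Fin l → Fin n, StrictMono i → StrictMono i' →
      MvPolynomial.coeff (∑ j, Finsupp.single (i j) (α j)) p =
        MvPolynomial.coeff (∑ j, Finsupp.single (i' j) (α j)) p

/-- The truncation `f(x_1, …, x_m)` of a power series `f` of bounded degree: set `x_i = 0` for
`i > m`. The sum is finite because only finitely many monomials in `x_1, …, x_m` of bounded degree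
exist (see `coeff_truncate`). -/
def truncate {k : Type*} [Field k] (f : MvPowerSeries ℕ k) (m : ℕ) : MvPolynomial (Fin m) k :=
  ∑ᶠ e : Fin m →₀ ℕ,
    MvPolynomial.monomial e (MvPowerSeries.coeff (e.mapDomain Fin.val) f)

theorem coeff_truncate {k : Type*} [Field k] {f : MvPowerSeries ℕ k}
    (hf : ∃ d : ℕ, ∀ e : ℕ →₀ ℕ, MvPowerSeries.coeff e f ≠ 0 → e.degree ≤ d)
    (m : ℕ) (e : Fin m →₀ ℕ) :
    MvPolynomial.coeff e (truncate f m) = MvPowerSeries.coeff (e.mapDomain Fin.val) f := by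
  classical
  obtain ⟨d, hd⟩ := hf
  have hfin : (Function.support fun e : Fin m →₀ ℕ => MvPolynomial.monomial e
      (MvPowerSeries.coeff (e.mapDomain Fin.val) f)).Finite := by
    refine (Finsupp.finite_of_degree_le (σ := Fin m) d).subset fun e he => ?_
    have h := hd (e.mapDomain Fin.val) fun h0 => he (by simp [h0])
    have h1 : (e.mapDomain Fin.val).degree = e.degree := by
      rw [Finsupp.degree_mapDomain]
    simpa [h1] using h
  rw [truncate, finsum_eq_sum _ hfin, MvPolynomial.coeff_sum]
  simp only [MvPolynomial.coeff_monomial, Finset.sum_ite_eq']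
  split_ifs with h
  · rfl
  · by_contra hne
    exact h (by simpa using fun h0 => hne h0.symm)

/-- The ideal of `k[x_1, …, x_n]` generated by the quasisymmetric polynomials without constant
term. -/
def qsymIdeal (k : Type*) [Field k] (n : ℕ) : Ideal (MvPolynomial (Fin n) k) :=
  Ideal.span {p | IsQuasisymmetricPoly p ∧ MvPolynomial.constantCoeff p = 0}

/-- The set of proper nonempty partial sums
`{α_1, α_1 + α_2, …, α_1 + ⋯ + α_{l - 1}} ⊆ {1, …, d - 1}` of a composition `α` of `d` with `l`
parts. -/
def partialSums {d : ℕ} (α : Composition d) : Finset ℕ :=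
  (Finset.Ioo 0 α.length).image α.sizeUpTo

open scoped Classical in
/-- The fundamental quasisymmetric polynomial `F_α(x_1, …, x_m)`: the sum of
`x_{i_1} ⋯ x_{i_d}` over `1 ≤ i_1 ≤ ⋯ ≤ i_d ≤ m` such that `i_j < i_{j+1}` whenever `j` is a
proper partial sum of `α`. (The position `j` has index `j - 1` in `Fin d`, so the condition
on positions `j`, `j + 1` concerns the indices `a = j - 1` and `b = j`.) -/
def fundamental (k : Type*) [Field k] {d : ℕ} (α : Composition d) (m : ℕ) :
    MvPolynomial (Fin m) k :=
  ∑ i : Fin d → Fin m with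
    Monotone i ∧ ∀ a b : Fin d, (b : ℕ) = a + 1 → (b : ℕ) ∈ partialSums α → i a < i b,
    ∏ a, MvPolynomial.X (i a)

/-- The statistic `n(α) = ∑_{1 ≤ i ≤ l} (i - 1) α_i` of a composition. -/
def nStat {d : ℕ} (α : Composition d) : ℕ :=
  ∑ i : Fin α.length, (i : ℕ) * α.blocksFun i

/-! ### The Klyachko algebras -/

/-- The ideal generated by `(q + 1) z_i ^ 2 - q z_i z_{i-1} - z_i z_{i+1}` for `i ∈ ℤ` and by the
`z_i` with `i ∉ I`. -/
def klyachkoIdeal {k : Type*} [Field k] (q : k) (I : Set ℤ) : Ideal (MvPolynomial ℤ k) :=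
  Ideal.span (Set.range fun i : ℤ =>
      MvPolynomial.C (q + 1) * MvPolynomial.X i ^ 2
        - MvPolynomial.C q * MvPolynomial.X i * MvPolynomial.X (i - 1)
        - MvPolynomial.X i * MvPolynomial.X (i + 1)) ⊔
    Ideal.span (MvPolynomial.X '' Iᶜ)

/-- The algebra `K_I`: generators `u_i`, `i ∈ ℤ`, and relations
`(q + 1) u_i ^ 2 = q u_i u_{i-1} + u_i u_{i+1}` for all `i`, and `u_i = 0` for `i ∉ I`. -/
abbrev Klyachko {k : Type*} [Field k] (q : k) (I : Set ℤ) : Type _ :=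
  MvPolynomial ℤ k ⧸ klyachkoIdeal q I

/-- The generator `u_i` of `K_I` (it is zero for `i ∉ I`). -/
def u {k : Type*} [Field k] (q : k) (I : Set ℤ) (i : ℤ) : Klyachko q I :=
  Ideal.Quotient.mk (klyachkoIdeal q I) (MvPolynomial.X i)

/-- The algebra `K_+`, where `u_i = 0` for `i ≤ 0`. -/
abbrev KlyachkoPos {k : Type*} [Field k] (q : k) : Type _ :=
  Klyachko q (Set.Ioi 0)

/-- The algebra `K_n`, where `u_i = 0` unless `1 ≤ i ≤ n - 1`. -/
abbrev KlyachkoFin {k : Type*} [Field k] (q : k) (n : ℕ) : Type _ :=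
  Klyachko q (Set.Ioo 0 (n : ℤ))

/-- The morphism `ρ_+ : k[x_1, x_2, …] → K_+`, `x_i ↦ u_i - u_{i-1}` (with `u_0 = 0`). -/
def rhoPos {k : Type*} [Field k] (q : k) : MvPolynomial ℕ k →ₐ[k] KlyachkoPos q :=
  MvPolynomial.aeval fun i : ℕ =>
    u q (Set.Ioi 0) ((i : ℤ) + 1) - u q (Set.Ioi 0) (i : ℤ)

/-- The morphism `ρ_n : k[x_1, …, x_n] → K_n`, `x_i ↦ u_i - u_{i-1}` (with `u_0 = u_n = 0`), that
is, `f ↦ f(u_1, u_2 - u_1, …, u_{n-1} - u_{n-2}, -u_{n-1})`. -/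
def rhoFin {k : Type*} [Field k] (q : k) (n : ℕ) :
    MvPolynomial (Fin n) k →ₐ[k] KlyachkoFin q n :=
  MvPolynomial.aeval fun i : Fin n =>
    u q (Set.Ioo 0 (n : ℤ)) ((i : ℤ) + 1) - u q (Set.Ioo 0 (n : ℤ)) (i : ℤ)

/-! ### q-divided symmetrization -/

/-- The field of rational functions in `x_1, …, x_n`. -/
abbrev RatFun (k : Type*) [Field k] (n : ℕ) : Type _ :=
  FractionRing (MvPolynomial (Fin n) k)

/-- The variable `x_{i+1}` as a rational function. -/
def ratX (k : Type*) [Field k] {n : ℕ} (i : Fin n) : RatFun k n :=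
  algebraMap (MvPolynomial (Fin n) k) (RatFun k n) (MvPolynomial.X i)

/-- The action of a permutation on rational functions by permuting the variables. -/
def permAct (k : Type*) [Field k] {n : ℕ} (w : Equiv.Perm (Fin n)) : RatFun k n ≃+* RatFun k n :=
  IsFractionRing.ringEquivOfRingEquiv (MvPolynomial.renameEquiv k w).toRingEquiv

/-- The operator `∂_{w_o}`: antisymmetrization followed by division by the Vandermonde product
`∏_{i < j} (x_i - x_j)`. -/
def partialLongest {k : Type*} [Field k] {n : ℕ} (g : RatFun k n) : RatFun k n :=
  (∑ w : Equiv.Perm (Fin n), ((Equiv.Perm.sign w : ℤ) : RatFun k n) * permAct k w g) /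
    ∏ i : Fin n, ∏ j ∈ Finset.Ioi i, (ratX k i - ratX k j)

/-- The operator `□_{w_o} = ∂_{w_o} ∏_{i < j} (q x_i - x_j)`: first multiply by the product, then
apply `∂_{w_o}`. -/
def squareLongest {k : Type*} [Field k] (q : k) {n : ℕ} (g : RatFun k n) : RatFun k n :=
  partialLongest
    ((∏ i : Fin n, ∏ j ∈ Finset.Ioi i, (algebraMap k (RatFun k n) q * ratX k i - ratX k j)) * g)

/-- The `q`-divided symmetrization
`⟨f⟩_n^q = □_{w_o} (f / ∏_{1 ≤ i ≤ n - 1} (q x_i - x_{i+1}))`. -/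
def qDS {k : Type*} [Field k] (q : k) {n : ℕ} (f : MvPolynomial (Fin n) k) : RatFun k n :=
  squareLongest q
    (algebraMap (MvPolynomial (Fin n) k) (RatFun k n) f /
      ∏ i : Fin n, ∏ j ∈ Finset.univ.filter (fun j : Fin n => (j : ℕ) = (i : ℕ) + 1),
        (algebraMap k (RatFun k n) q * ratX k i - ratX k j))

end QKlyachko

end

/-!
Homogeneous quasisymmetric polynomials are combinations of fundamental ones. If a sequence `v` with
`v 0 = 0` satisfies the Klyachko relations, then an induction on the degree and on the number of
variables turns the value of a fundamental quasisymmetric polynomial of degree `r` at the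
differences `v (i + 1) - v i` into a multiple of a product of `r` consecutive terms of `v`, which
vanishes as soon as `v n = 0` for one of these terms.

Three sequences matter. For the generators `u_j` this computes `ρ_+` and `ρ_n`. For the `q`-integers
the differences are the powers of `q`, and the `q`-binomial theorem gives the generating function of
principal specializations. For the partial sums `x_1 + ⋯ + x_j` in the polynomial ring modulo the
Klyachko relations, it reduces everything in degree `r` to multiples of `(-x_2) ⋯ (-x_{r+1})`; the
`q`-divided symmetrization kills the Klyachko relations in degree `r` and maps this monomial to `1`.
-/

noncomputable section

namespace QKlyachko

open Finset

/-! ### Words and fundamental quasisymmetric polynomials -/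

section Words

variable {X : Type*} [Preorder X] {S : Finset ℕ} {r m : ℕ}

/-- Weakly increasing words which increase strictly at the positions in `S`; the monomials of a
fundamental quasisymmetric polynomial are indexed by such words. -/
def IsWord (S : Finset ℕ) (i : Fin r → X) : Prop :=
  Monotone i ∧ ∀ a b : Fin r, (b : ℕ) = a + 1 → (b : ℕ) ∈ S → i a < i b

theorem monotone_snoc_iff (i : Fin r → X) (j : X) :
    Monotone (Fin.snoc i j : Fin (r + 1) → X) ↔ Monotone i ∧ ∀ a, i a ≤ j := by
  simp only [Monotone, Fin.forall_fin_succ', Fin.snoc_castSucc, Fin.snoc_last,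
    Fin.castSucc_le_castSucc_iff, Fin.le_last, (Fin.castSucc_lt_last _).not_ge, forall_const,
    IsEmpty.forall_iff, implies_true, le_refl, and_true, forall_and]

theorem isWord_snoc_iff (i : Fin r → ℕ) (j : ℕ) :
    IsWord S (Fin.snoc i j : Fin (r + 1) → ℕ) ↔
      IsWord S i ∧ ∀ a, i a < if r ∈ S then j else j + 1 := by
  have hstrict : (∀ a b : Fin (r + 1), (b : ℕ) = a + 1 → (b : ℕ) ∈ S →
        (Fin.snoc i j : Fin (r + 1) → ℕ) a < (Fin.snoc i j : Fin (r + 1) → ℕ) b) ↔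
      (∀ a b : Fin r, (b : ℕ) = a + 1 → (b : ℕ) ∈ S → i a < i b) ∧
        ∀ a : Fin r, r = a + 1 → r ∈ S → i a < j := by
    have hne (a : Fin r) : (a : ℕ) ≠ r + 1 := by omega
    simp only [Fin.forall_fin_succ', Fin.snoc_castSucc, Fin.snoc_last, Fin.val_castSucc,
      Fin.val_last, hne, Nat.left_eq_add, one_ne_zero, IsEmpty.forall_iff, implies_true,
      and_true, forall_and]
  rw [IsWord, IsWord, monotone_snoc_iff, hstrict, and_and_and_comm]
  refine and_congr_right fun hi => ?_
  rcases r with _ | r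
  · simp
  have hle (a : Fin (r + 1)) : i a ≤ i (Fin.last r) := hi.1 (Fin.le_last a)
  refine ⟨fun h a => ?_, fun h => ⟨fun a => ?_, fun a _ hr => ?_⟩⟩
  · split_ifs with hr
    · exact (hle a).trans_lt (h.2 _ rfl hr)
    · exact Nat.lt_succ_of_le (h.1 a)
  · have := h a
    split_ifs at this <;> omega
  · simpa only [if_pos hr] using h a

end Words

section FundamentalEval

variable {A : Type*} [CommSemiring A]

/-- The value `F_S(x_0, …, x_{m-1})` of the fundamental quasisymmetric polynomial of degree `r`
with strict increases at the positions in `S`, by recursion on the last letter of the words. -/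
def fundamentalEval (x : ℕ → A) (S : Finset ℕ) : ℕ → ℕ → A
  | 0, _ => 1
  | r + 1, m => ∑ j ∈ range m, x j * fundamentalEval x S r (if r ∈ S then j else j + 1)

theorem fundamentalEval_succ_succ (x : ℕ → A) (S : Finset ℕ) (r m : ℕ) :
    fundamentalEval x S (r + 1) (m + 1) = fundamentalEval x S (r + 1) m +
      x m * fundamentalEval x S r (if r ∈ S then m else m + 1) := by
  simp only [fundamentalEval, sum_range_succ]

open scoped Classical in
theorem fundamentalEval_eq_sum_piFinset (x : ℕ → A) (S : Finset ℕ) (r m : ℕ) :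
    fundamentalEval x S r m =
      ∑ i ∈ Fintype.piFinset fun _ : Fin r => range m with IsWord S i, ∏ a, x (i a) := by
  induction r generalizing m with
  | zero =>
    have hword (i : Fin 0 → ℕ) : IsWord S i := ⟨fun a => a.elim0, fun a => a.elim0⟩
    simp [fundamentalEval, hword]
  | succ r ih =>
    simp only [fundamentalEval, ih, mul_sum]
    rw [sum_sigma']
    refine sum_bij' (fun p _ => (Fin.snoc p.2 p.1 : Fin (r + 1) → ℕ))
      (fun i _ => ⟨i (Fin.last r), Fin.init i⟩) ?_ ?_ ?_ ?_ ?_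
    · rintro ⟨j, i⟩ h
      have hlt (hj : j < m) (a) (ha : i a < if r ∈ S then j else j + 1) : i a < m := by
        split_ifs at ha <;> omega
      simp only [mem_sigma, mem_range, mem_filter, Fintype.mem_piFinset] at h
      simpa [Fin.forall_fin_succ', isWord_snoc_iff, h.1, h.2.1, h.2.2] using
        fun a => hlt h.1 a (h.2.1 a)
    · intro i h
      rw [← Fin.snoc_init_self i, mem_filter, isWord_snoc_iff] at h
      simpa [Fin.forall_fin_succ', h.2.1, h.2.2] using (Fintype.mem_piFinset.1 h.1) (Fin.last r)
    · simp
    · simp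
    · simp [Fin.prod_univ_castSucc, mul_comm]

open scoped Classical in
theorem fundamentalEval_eq_sum (x : ℕ → A) (S : Finset ℕ) (r m : ℕ) :
    fundamentalEval x S r m = ∑ i : Fin r → Fin m with IsWord S i, ∏ a, x (i a) := by
  rw [fundamentalEval_eq_sum_piFinset]
  refine (sum_bij (fun i _ a => (i a : ℕ)) (fun i h => ?_) (fun i _ i' _ h => ?_)
    (fun i h => ?_) fun _ _ => rfl).symm
  · have hi : IsWord S fun a => (i a : ℕ) := (mem_filter.1 h).2
    simpa using hi
  · exact funext fun a => Fin.ext (congrFun h a)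
  · simp only [mem_filter, Fintype.mem_piFinset, mem_range] at h
    have hi : IsWord S fun a => (⟨i a, h.1 a⟩ : Fin m) := h.2
    exact ⟨_, by simpa using hi, rfl⟩

end FundamentalEval

section FundamentalOfSet

open MvPolynomial

variable (R : Type*) [CommSemiring R]

open scoped Classical in
/-- The fundamental quasisymmetric polynomial of degree `r` in `m` variables with strict increases
at the positions in `S`; this is `fundamental`, with the composition replaced by its set of
partial sums. -/
def fundamentalOfSet (S : Finset ℕ) (r m : ℕ) : MvPolynomial (Fin m) R :=
  ∑ i : Fin r → Fin m with IsWord S i, ∏ a, X (i a)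

theorem fundamental_eq_fundamentalOfSet (k : Type*) [Field k] {d : ℕ} (α : Composition d) (m : ℕ) :
    fundamental k α m = fundamentalOfSet k (partialSums α) d m := by
  classical
  unfold fundamental fundamentalOfSet
  exact sum_congr (ext fun _ => by rw [mem_filter, mem_filter]; rfl) fun _ _ => rfl

theorem isHomogeneous_fundamentalOfSet (S : Finset ℕ) (r m : ℕ) :
    (fundamentalOfSet R S r m).IsHomogeneous r :=
  IsHomogeneous.sum _ _ _ fun i _ => by
    simpa using IsHomogeneous.prod univ (fun a => X (R := R) (i a)) (fun _ => 1)
      fun a _ => isHomogeneous_X R (i a)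

theorem aeval_fundamentalOfSet {A : Type*} [CommSemiring A] [Algebra R A] (x : ℕ → A)
    (S : Finset ℕ) (r m : ℕ) :
    aeval (fun i : Fin m => x i) (fundamentalOfSet R S r m) = fundamentalEval x S r m := by
  simp [fundamentalOfSet, fundamentalEval_eq_sum]

end FundamentalOfSet

/-! ### The number of parts and the statistic `n` -/

/-- The number of parts of a composition of `r` with set of partial sums `S ∩ {1, …, r - 1}`. -/
def numParts (S : Finset ℕ) (r : ℕ) : ℕ := #{j ∈ range r | j = 0 ∨ j ∈ S}

/-- The statistic `n(α)` in terms of the set of partial sums: the `(j + 1)`-st unit of `α` lies in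
the part with number `numParts S (j + 1)` and contributes `numParts S (j + 1) - 1`. -/
def descStat (S : Finset ℕ) (r : ℕ) : ℕ := ∑ j ∈ range r, (numParts S (j + 1) - 1)

section NumParts

variable (S : Finset ℕ) (r : ℕ)

@[simp] theorem numParts_zero : numParts S 0 = 0 := by simp [numParts]

theorem numParts_succ : numParts S (r + 1) = numParts S r + if r = 0 ∨ r ∈ S then 1 else 0 := by
  rw [numParts, numParts, card_filter, card_filter, sum_range_succ]

theorem numParts_le : numParts S r ≤ r :=
  (card_filter_le _ _).trans (card_range r).le

theorem numParts_pos {r : ℕ} (hr : 0 < r) : 0 < numParts S r :=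
  card_pos.2 ⟨0, by simp [hr]⟩

theorem descStat_succ : descStat S (r + 1) = descStat S r + (numParts S (r + 1) - 1) :=
  sum_range_succ _ _

variable {A : Type*} [CommSemiring A] (x : ℕ → A)

theorem fundamentalEval_eq_zero {r m : ℕ} (h : m < numParts S r) :
    fundamentalEval x S r m = 0 := by
  induction r generalizing m with
  | zero => simp at h
  | succ r ih =>
    refine sum_eq_zero fun j hj => ?_
    rw [ih, mul_zero]
    rw [numParts_succ] at h
    rw [mem_range] at hj
    rcases r with _ | r <;> grind [numParts_zero]

theorem fundamentalEval_succ_add {l : ℕ} (hl : numParts S (r + 1) = l + 1) (s : ℕ) :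
    fundamentalEval x S (r + 1) (s + l + 1) = fundamentalEval x S (r + 1) (s + l) +
      x (s + l) * fundamentalEval x S r (s + numParts S r) := by
  rw [fundamentalEval_succ_succ]
  congr 2
  rw [numParts_succ] at hl
  rcases r with _ | r
  · rfl
  · congr 1
    split_ifs at hl ⊢ <;> grind

end NumParts

/-! ### Klyachko sequences -/

section KlyachkoSeq

/-- The Klyachko relations `(q + 1) v_j ^ 2 = q v_j v_{j-1} + v_j v_{j+1}`, `j ≥ 1`, written in
terms of the differences of consecutive terms. -/
def IsKlyachkoSeq {A : Type*} [CommRing A] (q : A) (v : ℕ → A) : Prop :=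
  ∀ j, v (j + 1) * fwdDiff 1 v (j + 1) = q * (v (j + 1) * fwdDiff 1 v j)

namespace IsKlyachkoSeq

variable {A : Type*} [CommRing A] {q : A} {v : ℕ → A}

theorem prod_mul_fwdDiff_add (hv : IsKlyachkoSeq q v) (s : ℕ) {r j : ℕ} (hj : j ≤ r) :
    (∏ i ∈ range r, v (s + i + 1)) * fwdDiff 1 v (s + j) =
      q ^ j * ((∏ i ∈ range r, v (s + i + 1)) * fwdDiff 1 v s) := by
  induction j with
  | zero => simp
  | succ j ih =>
    rw [pow_succ', mul_assoc, ← ih (by omega), ← mul_prod_erase (range r) _ (mem_range.2 hj)]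
    linear_combination (∏ i ∈ (range r).erase j, v (s + i + 1)) * hv (s + j)

theorem prod_mul_sub (hv : IsKlyachkoSeq q v) (s r : ℕ) :
    (∏ i ∈ range r, v (s + i + 1)) * (v (s + r + 1) - v s) =
      (∑ i ∈ range (r + 1), q ^ i) * ((∏ i ∈ range r, v (s + i + 1)) * fwdDiff 1 v s) := by
  have htele : ∑ j ∈ range (r + 1), fwdDiff 1 v (s + j) = v (s + r + 1) - v s :=
    sum_range_sub (fun j => v (s + j)) (r + 1)
  rw [← htele, mul_sum, sum_mul]
  exact sum_congr rfl fun j hj => hv.prod_mul_fwdDiff_add s (mem_range_succ_iff.1 hj)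

theorem geomSum_mul_prod_mul_fwdDiff (hv : IsKlyachkoSeq q v) (s : ℕ) {r j : ℕ} (hj : j ≤ r) :
    (∑ i ∈ range (r + 1), q ^ i) * ((∏ i ∈ range r, v (s + i + 1)) * fwdDiff 1 v (s + j)) =
      q ^ j * (∏ i ∈ range (r + 1), v (s + i + 1) - ∏ i ∈ range (r + 1), v (s + i)) := by
  have hshift : ∏ i ∈ range (r + 1), v (s + i) = (∏ i ∈ range r, v (s + i + 1)) * v s :=
    prod_range_succ' _ r
  rw [hv.prod_mul_fwdDiff_add s hj, mul_left_comm, ← hv.prod_mul_sub, prod_range_succ, hshift,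
    mul_sub]

/-- A fundamental quasisymmetric polynomial in the differences of a Klyachko sequence is a product
of consecutive terms: both sides grow by the same amount when `s` is increased. -/
theorem prod_geomSum_mul_fundamentalEval (hv : IsKlyachkoSeq q v) (h0 : v 0 = 0) (S : Finset ℕ)
    (r s : ℕ) :
    (∏ i ∈ range r, ∑ j ∈ range (i + 1), q ^ j) *
        fundamentalEval (fwdDiff 1 v) S r (s + numParts S r) =
      q ^ descStat S r * ∏ i ∈ range r, v (s + i + 1) := by
  induction r generalizing s with
  | zero => simp [fundamentalEval, descStat]
  | succ r ihr =>
    obtain ⟨l, hl⟩ : ∃ l, numParts S (r + 1) = l + 1 :=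
      Nat.exists_eq_add_one_of_ne_zero (numParts_pos S r.succ_pos).ne'
    have hlr : l ≤ r := by have := numParts_le S (r + 1); omega
    have hdesc : descStat S (r + 1) = descStat S r + l := by rw [descStat_succ, hl]; rfl
    rw [hl, hdesc]
    have hstep (s : ℕ) := fundamentalEval_succ_add S r (fwdDiff 1 v) hl s
    have hgrow (s : ℕ) := hv.geomSum_mul_prod_mul_fwdDiff s hlr
    suffices ∀ s, (∏ i ∈ range (r + 1), ∑ j ∈ range (i + 1), q ^ j) *
        fundamentalEval (fwdDiff 1 v) S (r + 1) (s + l) =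
          q ^ (descStat S r + l) * ∏ i ∈ range (r + 1), v (s + i) by
      simpa only [add_right_comm s 1, add_assoc s l] using this (s + 1)
    intro s
    induction s with
    | zero =>
      have hzero : fundamentalEval (fwdDiff 1 v) S (r + 1) l = 0 :=
        fundamentalEval_eq_zero S _ (by omega)
      simp [prod_range_succ', h0, hzero]
    | succ s ihs =>
      simp only [add_right_comm s 1, hstep]
      rw [prod_range_succ (fun i => ∑ j ∈ range (i + 1), q ^ j)] at ihs ⊢
      linear_combination ihs + (∑ i ∈ range (r + 1), q ^ i) * fwdDiff 1 v (s + l) * ihr s +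
        q ^ descStat S r * hgrow s

theorem prod_geomSum_mul_prod_neg_fwdDiff (hv : IsKlyachkoSeq q v) {s r : ℕ}
    (hr : v (s + r + 1) = 0) :
    (∏ i ∈ range r, ∑ j ∈ range (i + 1), q ^ j) * ∏ i ∈ range r, -fwdDiff 1 v (s + i + 1) =
      ∏ i ∈ range r, v (s + i + 1) := by
  induction r generalizing s with
  | zero => simp
  | succ r ih =>
    have hr' : v (s + 1 + r + 1) = 0 := by rwa [add_right_comm s 1]
    have htail := ih hr'
    have hhead := hv.prod_mul_sub (s + 1) r
    rw [hr'] at hhead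
    rw [prod_range_succ, prod_range_succ' (fun i => -fwdDiff 1 v (s + i + 1)),
      prod_range_succ' (fun i => v (s + i + 1))]
    simp only [add_right_comm s 1, add_zero, ← add_assoc] at *
    linear_combination -(∑ i ∈ range (r + 1), q ^ i) * fwdDiff 1 v (s + 1) * htail + hhead

end IsKlyachkoSeq

end KlyachkoSeq

/-! ### Compositions -/

section Compositions

variable {d : ℕ} (α : Composition d)

theorem strictMonoOn_sizeUpTo : StrictMonoOn α.sizeUpTo (Set.Iic α.length) :=
  fun _ _ _ hj hij =>
    (α.sizeUpTo_strict_mono (lt_of_lt_of_le hij hj)).trans_le (α.monotone_sizeUpTo hij)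

theorem numParts_partialSums_eq {c e : ℕ} (he : e ≤ d) (hc : c ≤ α.length)
    (h : ∀ i < α.length, α.sizeUpTo i < e ↔ i < c) : numParts (partialSums α) e = c := by
  have himage : {t ∈ range e | t = 0 ∨ t ∈ partialSums α} = (range c).image α.sizeUpTo := by
    ext t
    rw [mem_filter, mem_range, partialSums, mem_image, mem_image]
    simp only [mem_Ioo, mem_range]
    constructor
    · rintro ⟨ht, rfl | ⟨i, hi, rfl⟩⟩
      · exact ⟨0, (h 0 (α.length_pos_iff.2 (ht.trans_le he))).1 (by simpa using ht), by simp⟩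
      · exact ⟨i, (h i hi.2).1 ht, rfl⟩
    · rintro ⟨i, hi, rfl⟩
      refine ⟨(h i (hi.trans_le hc)).2 hi, ?_⟩
      rcases i.eq_zero_or_pos with rfl | hi0
      · simp
      · exact .inr ⟨i, ⟨hi0, hi.trans_le hc⟩, rfl⟩
  rw [numParts, himage, card_image_of_injOn, card_range]
  exact (strictMonoOn_sizeUpTo α).injOn.mono fun i hi => (mem_range.1 hi).le.trans hc

theorem numParts_partialSums : numParts (partialSums α) d = α.length :=
  numParts_partialSums_eq α le_rfl le_rfl fun i hi => by
    simpa [hi] using strictMonoOn_sizeUpTo α hi.le Set.self_mem_Iic hi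

theorem numParts_partialSums_succ (j : Fin d) :
    numParts (partialSums α) (j + 1) = α.index j + 1 :=
  numParts_partialSums_eq α j.is_lt (α.index j).is_lt fun i _ => by
    have hlast := α.sizeUpTo_index_le j
    have hnext : (j : ℕ) < α.sizeUpTo (α.index j + 1) := α.lt_sizeUpTo_index_succ j
    rw [Nat.lt_succ_iff, Nat.lt_succ_iff]
    refine ⟨fun hi => ?_, fun hi => (α.monotone_sizeUpTo hi).trans hlast⟩
    by_contra! hlt
    have := α.monotone_sizeUpTo (Nat.add_one_le_of_lt hlt)
    omega

theorem descStat_partialSums : descStat (partialSums α) d = nStat α := by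
  rw [descStat, ← Fin.sum_univ_eq_sum_range
    (fun j => numParts (partialSums α) (j + 1) - 1), nStat]
  simp only [numParts_partialSums_succ, Nat.add_sub_cancel]
  rw [← α.blocksFinEquiv.sum_comp, Fintype.sum_sigma]
  exact sum_congr rfl fun i _ => by simp [Composition.blocksFinEquiv, mul_comm]

end Compositions

/-! ### Evaluations in algebras over a field -/

section QFactorial

variable {k : Type*} [Field k] {q : k}

theorem qInt_ne_zero [CharZero k] (hq : ∀ n : ℕ, 0 < n → q ^ n = 1 → q = 1) {n : ℕ}
    (hn : 0 < n) : qInt q n ≠ 0 := by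
  intro h
  have hpow : q ^ n = 1 := sub_eq_zero.1 <| by rw [← geom_sum_mul, ← qInt, h, zero_mul]
  rw [hq n hn hpow] at h
  simp [qInt, hn.ne'] at h

theorem qFactorial_ne_zero (hq : ∀ n, 0 < n → qInt q n ≠ 0) (r : ℕ) : qFactorial q r ≠ 0 :=
  prod_ne_zero_iff.2 fun i _ => hq (i + 1) i.succ_pos

variable {A : Type*} [CommRing A] [Algebra k A] {v : ℕ → A} {r : ℕ}

theorem algebraMap_qFactorial : algebraMap k A (qFactorial q r) =
    ∏ i ∈ range r, ∑ j ∈ range (i + 1), algebraMap k A q ^ j := by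
  simp [qFactorial, qInt]

theorem eq_smul_of_algebraMap_mul_eq {c d : k} (hc : c ≠ 0) {x y : A}
    (h : algebraMap k A c * x = algebraMap k A d * y) : x = (d / c) • y := by
  rw [← Algebra.smul_def, ← Algebra.smul_def] at h
  rw [div_eq_inv_mul, mul_smul, ← h, inv_smul_smul₀ hc]

namespace IsKlyachkoSeq

theorem fundamentalEval_eq_smul (hr : qFactorial q r ≠ 0)
    (hv : IsKlyachkoSeq (algebraMap k A q) v) (h0 : v 0 = 0) (S : Finset ℕ) (s : ℕ) :
    fundamentalEval (fwdDiff 1 v) S r (s + numParts S r) =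
      (q ^ descStat S r / qFactorial q r) • ∏ i ∈ range r, v (s + i + 1) :=
  eq_smul_of_algebraMap_mul_eq hr <| by
    rw [algebraMap_qFactorial, map_pow, hv.prod_geomSum_mul_fundamentalEval h0]

theorem fundamentalEval_eq_zero_of_ne (hr : qFactorial q r ≠ 0)
    (hv : IsKlyachkoSeq (algebraMap k A q) v) (h0 : v 0 = 0) {n : ℕ} (hn : v n = 0)
    (S : Finset ℕ) {m : ℕ} (hm : m < n + numParts S r) (hnr : n + numParts S r ≤ r + m) :
    fundamentalEval (fwdDiff 1 v) S r m = 0 := by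
  rcases lt_or_ge m (numParts S r) with hlt | hle
  · exact fundamentalEval_eq_zero S _ hlt
  obtain ⟨s, rfl⟩ := Nat.exists_eq_add_of_le' hle
  rw [hv.fundamentalEval_eq_smul hr h0, prod_eq_zero (i := n - 1 - s), smul_zero]
  · rw [mem_range]; omega
  · rwa [show s + (n - 1 - s) + 1 = n by omega]

theorem prod_neg_fwdDiff_eq_smul (hr : qFactorial q r ≠ 0)
    (hv : IsKlyachkoSeq (algebraMap k A q) v) (hlast : v (r + 1) = 0) :
    ∏ i ∈ range r, -fwdDiff 1 v (i + 1) =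
      (1 / qFactorial q r) • ∏ i ∈ range r, v (i + 1) :=
  eq_smul_of_algebraMap_mul_eq hr <| by
    have h := hv.prod_geomSum_mul_prod_neg_fwdDiff (s := 0) (r := r) (by simpa using hlast)
    simpa [algebraMap_qFactorial] using h

end IsKlyachkoSeq

/-! ### Principal specializations -/

theorem fwdDiff_qInt : fwdDiff 1 (qInt q) = fun j => q ^ j :=
  funext fun j => by simp [fwdDiff, qInt, sum_range_succ]

theorem isKlyachkoSeq_qInt : IsKlyachkoSeq q (qInt q) := fun j => by
  simp only [fwdDiff_qInt]
  ring

end QFactorial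

section PrincipalSpecialization

open PowerSeries

variable {k : Type*} [Field k] (q : k)

theorem rescale_C {R : Type*} [CommSemiring R] (a b : R) : rescale a (C b) = C b := by
  ext (_ | j) <;> simp [coeff_C]

theorem one_sub_X_mul_rescale_qPochhammer (r : ℕ) :
    (1 - X) * rescale q (qPochhammer q r) = qPochhammer q (r + 1) := by
  simp only [qPochhammer]
  rw [prod_range_succ', map_prod, mul_comm]
  congr 1
  · refine prod_congr rfl fun i _ => ?_
    rw [map_sub, map_mul, map_one, rescale_X, rescale_C, pow_succ', map_mul]
    ring
  · simp

theorem one_sub_X_mul_mk_prod_qInt (r : ℕ) :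
    (1 - X) * PowerSeries.mk (fun s => ∏ i ∈ range (r + 1), qInt q (s + i + 1)) =
      C (qInt q (r + 1)) *
        rescale q (PowerSeries.mk fun s => ∏ i ∈ range r, qInt q (s + i + 1)) := by
  ext (_ | s)
  · simp [prod_range_succ, mul_comm]
  · have hgrow := (isKlyachkoSeq_qInt (q := q)).geomSum_mul_prod_mul_fwdDiff (s + 1) r.zero_le
    rw [fwdDiff_qInt, ← qInt, pow_zero, one_mul, add_zero] at hgrow
    simp only [sub_mul, one_mul, map_sub, coeff_succ_X_mul, coeff_mk, coeff_C_mul, coeff_rescale]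
    rw [mul_comm (q ^ _), hgrow]
    simp only [add_right_comm s 1]

/-- The `q`-binomial theorem, with both sides multiplied by `[r]_q!`. -/
theorem mk_prod_qInt_mul_qPochhammer (r : ℕ) :
    PowerSeries.mk (fun s => ∏ i ∈ range r, qInt q (s + i + 1)) * qPochhammer q (r + 1) =
      C (qFactorial q r) := by
  induction r with
  | zero =>
    have hgeom : PowerSeries.mk (fun _ => 1) * (1 - X : k⟦X⟧) = 1 := mk_one_mul_one_sub_eq_one k
    simpa [qPochhammer, qFactorial] using hgeom
  | succ r ih =>
    rw [← one_sub_X_mul_rescale_qPochhammer, mul_left_comm, ← mul_assoc,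
      one_sub_X_mul_mk_prod_qInt, mul_assoc, ← map_mul, ih, rescale_C, ← map_mul, mul_comm,
      qFactorial, qFactorial, prod_range_succ]

theorem mk_fundamentalEval_pow_mul_qPochhammer {r : ℕ} (hr : qFactorial q r ≠ 0)
    (S : Finset ℕ) :
    PowerSeries.mk (fundamentalEval (fun j => q ^ j) S r) * qPochhammer q (r + 1) =
      C (q ^ descStat S r) * X ^ numParts S r := by
  have hmk : PowerSeries.mk (fundamentalEval (fun j => q ^ j) S r) =
      C (q ^ descStat S r / qFactorial q r) *
        (X ^ numParts S r * PowerSeries.mk fun s => ∏ i ∈ range r, qInt q (s + i + 1)) := by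
    ext m
    rw [coeff_mk, coeff_C_mul, coeff_X_pow_mul']
    split_ifs with hm
    · obtain ⟨s, rfl⟩ := Nat.exists_eq_add_of_le' hm
      rw [Nat.add_sub_cancel, coeff_mk]
      have hq : IsKlyachkoSeq (algebraMap k k q) (qInt q) := isKlyachkoSeq_qInt
      have h := hq.fundamentalEval_eq_smul hr (by simp [qInt]) S s
      rwa [fwdDiff_qInt, smul_eq_mul] at h
    · rw [fundamentalEval_eq_zero S _ (not_le.1 hm), mul_zero]
  rw [hmk, mul_assoc, mul_assoc, mk_prod_qInt_mul_qPochhammer, mul_left_comm, ← map_mul,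
    div_mul_cancel₀ _ hr, mul_comm]

end PrincipalSpecialization

/-! ### Expansion of quasisymmetric polynomials in the fundamental ones -/

section Ascents

variable {X : Type*} {r : ℕ}

/-- The set of positions of the strict increases of a word. -/
def ascents [Preorder X] [DecidableLT X] (i : Fin r → X) : Finset ℕ :=
  {t ∈ Ioo 0 r | ∃ a b : Fin r, (b : ℕ) = a + 1 ∧ (b : ℕ) = t ∧ i a < i b}

theorem ascents_subset [Preorder X] [DecidableLT X] (i : Fin r → X) : ascents i ⊆ Ioo 0 r :=
  filter_subset _ _

theorem mem_ascents [Preorder X] [DecidableLT X] (i : Fin r → X) {a b : Fin r}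
    (hab : (b : ℕ) = a + 1) : (b : ℕ) ∈ ascents i ↔ i a < i b := by
  rw [ascents, mem_filter, mem_Ioo]
  refine ⟨?_, fun h => ⟨⟨by omega, b.is_lt⟩, a, b, hab, rfl, h⟩⟩
  rintro ⟨-, a', b', h1, h2, h3⟩
  obtain rfl : b' = b := Fin.ext h2
  obtain rfl : a' = a := Fin.ext (by omega)
  exact h3

theorem isWord_iff_subset_ascents [Preorder X] [DecidableLT X] {S : Finset ℕ} (hS : S ⊆ Ioo 0 r)
    {i : Fin r → X} (hi : Monotone i) : IsWord S i ↔ S ⊆ ascents i := by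
  refine ⟨fun h t ht => ?_, fun h => ⟨hi, fun a b hab hb => (mem_ascents i hab).1 (h hb)⟩⟩
  obtain ⟨h0, h1⟩ := mem_Ioo.1 (hS ht)
  have hsucc : t = t - 1 + 1 := by omega
  exact (mem_ascents i (a := ⟨t - 1, by omega⟩) (b := ⟨t, h1⟩) hsucc).2 (h.2 _ _ hsucc ht)

theorem lt_iff_exists_mem_ascents [LinearOrder X] {i : Fin r → X} (hi : Monotone i)
    (a b : Fin r) : i a < i b ↔ ∃ t ∈ ascents i, (a : ℕ) < t ∧ t ≤ b := by
  constructor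
  · intro hab
    let c := ({c | i a < i c} : Finset (Fin r)).min' ⟨b, by simpa using hab⟩
    have hac : i a < i c := by simpa using min'_mem {c | i a < i c} _
    have hle (d) (hd : i a < i d) : c ≤ d := min'_le _ d (by simpa using hd)
    have hlt : (a : ℕ) < c := hi.reflect_lt hac
    let d : Fin r := ⟨c - 1, by omega⟩
    have hcd : (c : ℕ) = d + 1 := (Nat.sub_add_cancel (by omega)).symm
    have hda : i d ≤ i a := not_lt.1 fun h => absurd (hle d h) (by rw [Fin.le_def]; omega)
    exact ⟨c, (mem_ascents i hcd).2 (hda.trans_lt hac), hlt, hle b hab⟩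
  · rintro ⟨t, ht, hat, htb⟩
    obtain ⟨-, c, d, hcd, rfl, hlt⟩ := mem_filter.1 ht
    exact (hi (by rw [Fin.le_def]; omega)).trans_lt (hlt.trans_le (hi htb))

end Ascents

section Content

variable {X : Type*} {r : ℕ}

/-- The exponent of the monomial of a word. -/
def content (i : Fin r → X) : X →₀ ℕ := ∑ a, Finsupp.single (i a) 1

theorem content_comp {l : ℕ} (x : Fin l → X) (τ : Fin r → Fin l) :
    content (x ∘ τ) = ∑ j, Finsupp.single (x j) #{a | τ a = j} := by
  rw [content, ← sum_fiberwise univ τ]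
  refine sum_congr rfl fun j _ => ?_
  rw [sum_congr rfl fun a ha => by rw [Function.comp_apply, (mem_filter.1 ha).2]]
  simp

theorem toMultiset_content (i : Fin r → X) :
    Finsupp.toMultiset (content i) = (List.ofFn i : Multiset X) := by
  rw [content, map_sum, ← Multiset.sum_map_singleton (List.ofFn i : Multiset X)]
  simp [List.sum_ofFn, List.map_ofFn]

theorem exists_monotone_content_eq [LinearOrder X] {e : X →₀ ℕ} (he : e.degree = r) :
    ∃ i : Fin r → X, Monotone i ∧ content i = e := by
  have hlength : ((Finsupp.toMultiset e).sort (· ≤ ·)).length = r := by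
    rw [Multiset.length_sort, Finsupp.card_toMultiset, ← he]
    rfl
  subst hlength
  refine ⟨((Finsupp.toMultiset e).sort (· ≤ ·)).get,
    (Multiset.pairwise_sort _ _).sortedLE.monotone_get, Multiset.toFinsupp.symm.injective ?_⟩
  change Finsupp.toMultiset _ = Finsupp.toMultiset _
  rw [toMultiset_content, List.ofFn_get, Multiset.sort_eq]

theorem eq_of_content_eq [PartialOrder X] {i i' : Fin r → X} (hi : Monotone i)
    (hi' : Monotone i') (h : content i = content i') : i = i' := by
  refine List.ofFn_injective (List.Perm.eq_of_sortedLE hi.sortedLE_ofFn hi'.sortedLE_ofFn ?_)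
  rw [← Multiset.coe_eq_coe, ← toMultiset_content, ← toMultiset_content, h]

theorem apply_content_eq_of_ascents_eq {β : Type*} [LinearOrder X] (f : (X →₀ ℕ) → β)
    (hf : ∀ (l : ℕ) (α : Fin l → ℕ), (∀ j, 0 < α j) →
      ∀ i i' : Fin l → X, StrictMono i → StrictMono i' →
        f (∑ j, Finsupp.single (i j) (α j)) = f (∑ j, Finsupp.single (i' j) (α j)))
    {i i' : Fin r → X} (hi : Monotone i) (hi' : Monotone i') (h : ascents i = ascents i') :
    f (content i) = f (content i') := by
  have hlt (a b) : i a < i b ↔ i' a < i' b := by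
    rw [lt_iff_exists_mem_ascents hi, lt_iff_exists_mem_ascents hi', h]
  let letters := (univ.image i).orderEmbOfFin rfl
  have hτ (a) : ∃ j, letters j = i a := by
    have : i a ∈ Set.range letters := by simp [letters]
    exact this
  choose τ hτ using hτ
  have hσ (j) : ∃ a, i a = letters j := by
    obtain ⟨a, -, ha⟩ := mem_image.1 ((univ.image i).orderEmbOfFin_mem rfl j)
    exact ⟨a, ha⟩
  choose σ hσ using hσ
  have hτσ (j) : τ (σ j) = j := letters.injective ((hτ _).trans (hσ j))
  have hστ (a) : i' (σ (τ a)) = i' a := by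
    have : i (σ (τ a)) = i a := (hσ _).trans (hτ a)
    simp only [le_antisymm_iff, ← not_lt, hlt] at this ⊢
    exact this
  rw [show i = letters ∘ τ from funext fun a => (hτ a).symm,
    show i' = (i' ∘ σ) ∘ τ from funext fun a => (hστ a).symm, content_comp, content_comp]
  refine hf _ _ (fun j => card_pos.2 ⟨σ j, by simp [hτσ]⟩) _ _ letters.strictMono
    fun j j' hj => (hlt _ _).1 ?_
  simpa [hσ] using hj

theorem exists_apply_content_eq {β : Type*} [Nonempty β] [LinearOrder X] (f : (X →₀ ℕ) → β)
    (hf : ∀ (l : ℕ) (α : Fin l → ℕ), (∀ j, 0 < α j) →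
      ∀ i i' : Fin l → X, StrictMono i → StrictMono i' →
        f (∑ j, Finsupp.single (i j) (α j)) = f (∑ j, Finsupp.single (i' j) (α j))) (r : ℕ) :
    ∃ γ : Finset ℕ → β, ∀ i : Fin r → X, Monotone i → f (content i) = γ (ascents i) := by
  have hfactors : Function.FactorsThrough (fun i : {i : Fin r → X // Monotone i} => f (content i.1))
      (fun i => ascents i.1) := fun i i' h => apply_content_eq_of_ascents_eq f hf i.2 i'.2 h
  exact ⟨Function.extend _ _ fun _ => Classical.arbitrary β,
    fun i hi => (hfactors.extend_apply _ ⟨i, hi⟩).symm⟩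

end Content

theorem exists_eq_sum_powerset {G : Type*} [AddCommGroup G] (γ : Finset ℕ → G) :
    ∃ c : Finset ℕ → G, ∀ S, γ S = ∑ T ∈ S.powerset, c T := by
  let c : Finset ℕ → G := Finset.strongInduction fun S ih =>
    γ S - ∑ T ∈ S.ssubsets.attach, ih T (mem_ssubsets.1 T.2)
  refine ⟨c, fun S => ?_⟩
  have hS : c S = γ S - ∑ T ∈ S.ssubsets, c T := by
    rw [← sum_attach]
    exact Finset.strongInduction_eq _ S
  rw [← add_sum_erase _ _ (mem_powerset_self S), hS]
  exact (sub_add_cancel _ _).symm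

section Expansion

open MvPolynomial

variable {R : Type*} [CommRing R] {m r : ℕ}

theorem coeff_content_fundamentalOfSet {T : Finset ℕ} (hT : T ⊆ Ioo 0 r) {i : Fin r → Fin m}
    (hi : Monotone i) :
    (fundamentalOfSet R T r m).coeff (content i) = if T ⊆ ascents i then 1 else 0 := by
  classical
  have hprod (i' : Fin r → Fin m) :
      ∏ a, (X (i' a) : MvPolynomial (Fin m) R) = monomial (content i') 1 :=
    (monomial_sum_one _ _).symm
  simp only [fundamentalOfSet, hprod, coeff_sum, coeff_monomial]
  rw [sum_filter, sum_eq_single i]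
  · simp only [isWord_iff_subset_ascents hT hi, if_true]
  · intro i' _ hne
    split_ifs with hword hcontent
    · exact absurd (eq_of_content_eq hword.1 hi hcontent) hne
    all_goals rfl
  · simp

theorem eq_sum_smul_fundamentalOfSet {p : MvPolynomial (Fin m) R} (hp : p.IsHomogeneous r)
    {γ c : Finset ℕ → R}
    (hγ : ∀ i : Fin r → Fin m, Monotone i → p.coeff (content i) = γ (ascents i))
    (hc : ∀ S, γ S = ∑ T ∈ S.powerset, c T) :
    p = ∑ T ∈ (Ioo 0 r).powerset, c T • fundamentalOfSet R T r m := by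
  have hsum : (∑ T ∈ (Ioo 0 r).powerset, c T • fundamentalOfSet R T r m).IsHomogeneous r :=
    IsHomogeneous.sum _ _ _ fun T _ => by
      rw [smul_eq_C_mul]
      simpa using (isHomogeneous_C _ _).mul (isHomogeneous_fundamentalOfSet R T r m)
  ext e
  by_cases he : e.degree = r
  · obtain ⟨i, hi, rfl⟩ := exists_monotone_content_eq he
    have hterm (T) (hT : T ∈ (Ioo 0 r).powerset) :
        (c T • fundamentalOfSet R T r m).coeff (content i) =
          if T ∈ (ascents i).powerset then c T else 0 := by
      rw [coeff_smul, coeff_content_fundamentalOfSet (mem_powerset.1 hT) hi, smul_eq_mul,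
        mul_ite, mul_one, mul_zero]
      simp only [mem_powerset]
    rw [hγ i hi, hc, coeff_sum, sum_congr rfl hterm, sum_ite_mem,
      inter_eq_right.2 (powerset_mono.2 (ascents_subset i))]
  · rw [hp.coeff_eq_zero he, hsum.coeff_eq_zero he]

end Expansion

section Quasisymmetric

open MvPolynomial

variable {k : Type*} [Field k] {r : ℕ}

theorem IsQuasisymmetricPoly.exists_eq_sum {m : ℕ} {p : MvPolynomial (Fin m) k}
    (hp : IsQuasisymmetricPoly p) (hr : p.IsHomogeneous r) :
    ∃ c : Finset ℕ → k, p = ∑ T ∈ (Ioo 0 r).powerset, c T • fundamentalOfSet k T r m := by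
  obtain ⟨γ, hγ⟩ := exists_apply_content_eq (fun e => p.coeff e) hp r
  obtain ⟨c, hc⟩ := exists_eq_sum_powerset γ
  exact ⟨c, eq_sum_smul_fundamentalOfSet hr hγ hc⟩

theorem IsQuasisymmetricPoly.homogeneousComponent {m : ℕ} {p : MvPolynomial (Fin m) k}
    (hp : IsQuasisymmetricPoly p) (d : ℕ) : IsQuasisymmetricPoly (p.homogeneousComponent d) := by
  intro l α hα i i' hi hi'
  simp only [coeff_homogeneousComponent, map_sum, Finsupp.degree_single]
  rw [hp l α hα i i' hi hi']

theorem isHomogeneous_truncate {f : MvPowerSeries ℕ k} (hf : IsQuasisymmetric f)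
    (hr : f.IsHomogeneous r) (m : ℕ) : (truncate f m).IsHomogeneous r := by
  intro e he
  rw [coeff_truncate hf.bounded] at he
  have hdegree : (e.mapDomain Fin.val).degree = r := by
    rw [Finsupp.degree_eq_weight_one]
    exact hr he
  rw [Finsupp.degree_mapDomain, Finsupp.degree_eq_weight_one] at hdegree
  exact hdegree

theorem isQuasisymmetricPoly_truncate {f : MvPowerSeries ℕ k} (hf : IsQuasisymmetric f) (m : ℕ) :
    IsQuasisymmetricPoly (truncate f m) := by
  intro l α hα i i' hi hi'
  simp only [coeff_truncate hf.bounded, Finsupp.mapDomain_finsetSum, Finsupp.mapDomain_single]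
  exact hf.coeff_eq l α hα _ _ (fun _ _ h => hi h) fun _ _ h => hi' h

theorem IsQuasisymmetric.exists_truncate_eq_sum {f : MvPowerSeries ℕ k} (hf : IsQuasisymmetric f)
    (hr : f.IsHomogeneous r) :
    ∃ c : Finset ℕ → k, ∀ m,
      truncate f m = ∑ T ∈ (Ioo 0 r).powerset, c T • fundamentalOfSet k T r m := by
  obtain ⟨γ, hγ⟩ := exists_apply_content_eq (fun e => MvPowerSeries.coeff e f) hf.coeff_eq r
  obtain ⟨c, hc⟩ := exists_eq_sum_powerset γ
  refine ⟨c, fun m =>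
    eq_sum_smul_fundamentalOfSet (isHomogeneous_truncate hf hr m) (fun i hi => ?_) hc⟩
  have hcontent : (content i).mapDomain Fin.val = content fun a => (i a : ℕ) := by
    simp [content, Finsupp.mapDomain_finsetSum]
  have hascents : ascents (fun a => (i a : ℕ)) = ascents i := by
    ext t
    simp [ascents]
  rw [coeff_truncate hf.bounded, hcontent, hγ (fun a => (i a : ℕ)) hi, hascents]

end Quasisymmetric

/-! ### Antisymmetrization -/

theorem sum_range_card_add_le_sum_of_injOn {ι : Type*} {s : Finset ι} {e : ι → ℕ} {c : ℕ}
    (he : Set.InjOn e s) (hc : ∀ a ∈ s, c ≤ e a) : ∑ j ∈ range #s, (c + j) ≤ ∑ a ∈ s, e a := by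
  have hcast : Set.InjOn (fun a => (e a : ℤ)) s := Nat.cast_injective.comp_injOn he
  have := sum_range_le_sum (s := s.image fun a => (e a : ℤ)) (c := c) (by simpa using hc)
  rw [card_image_of_injOn hcast, sum_image hcast] at this
  rw [← Nat.cast_le (α := ℤ)]
  push_cast
  exact this

theorem sum_range_card_le_sum_of_injOn {ι : Type*} {s : Finset ι} {e : ι → ℕ}
    (he : Set.InjOn e s) : ∑ j ∈ range #s, j ≤ ∑ a ∈ s, e a := by
  simpa using sum_range_card_add_le_sum_of_injOn (c := 0) he

theorem exists_eq_of_degree_lt {σ : Type*} [Fintype σ] (P : σ → Prop) [DecidablePred P]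
    {e : σ →₀ ℕ}
    (h : e.degree < ∑ j ∈ range #{a | P a}, j + ∑ j ∈ range #{a | ¬P a}, j) :
    ∃ a b, a ≠ b ∧ (P a ↔ P b) ∧ e a = e b := by
  by_contra! hne
  have hinj (s : Finset σ) (hs : ∀ a ∈ s, ∀ b ∈ s, P a ↔ P b) : Set.InjOn e s :=
    fun a ha b hb hab => not_imp_comm.1 (hne a b · (hs a ha b hb)) (not_not.2 hab)
  refine h.not_ge ?_
  rw [Finsupp.degree_eq_sum, ← sum_filter_add_sum_filter_not univ P]
  exact add_le_add (sum_range_card_le_sum_of_injOn (hinj _ fun a ha b hb => by simp_all))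
    (sum_range_card_le_sum_of_injOn (hinj _ fun a ha b hb => by simp_all))

section Antisymmetrization

open MvPolynomial Equiv

variable {R σ : Type*} [CommRing R] [DecidableEq σ]

theorem rename_swap_monomial {e : σ →₀ ℕ} {a b : σ} (hab : e a = e b) (c : R) :
    rename (swap a b) (monomial e c) = monomial e c := by
  rw [rename_monomial]
  refine congrArg (fun d => monomial d c) (Finsupp.ext fun i => ?_)
  rw [← Finsupp.equivMapDomain_eq_mapDomain, Finsupp.equivMapDomain_apply, symm_swap]
  rcases eq_or_ne i a with rfl | hia
  · rw [swap_apply_left, hab]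
  rcases eq_or_ne i b with rfl | hib
  · rw [swap_apply_right, hab]
  rw [swap_apply_of_ne_of_ne hia hib]

theorem swap_preserves {P : σ → Prop} {a b : σ} (hab : P a ↔ P b) (c : σ) :
    P (swap a b c) ↔ P c := by
  rw [swap_apply_def]
  split_ifs with ha hb
  · rw [ha, hab]
  · rw [hb, hab]
  · rfl

variable [Fintype σ]

variable (R σ) in
/-- The antisymmetrization `∑_w sgn(w) w(p)` of polynomials. -/
def antisym : MvPolynomial σ R →ₗ[R] MvPolynomial σ R :=
  ∑ w : Perm σ, Perm.sign w • (rename w).toLinearMap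

theorem antisym_apply (p : MvPolynomial σ R) :
    antisym R σ p = ∑ w : Perm σ, Perm.sign w • rename w p := by
  simp [antisym]

theorem antisym_eq_zero_of_rename_swap {p : MvPolynomial σ R} {a b : σ} (hab : a ≠ b)
    (hp : rename (swap a b) p = p) : antisym R σ p = 0 := by
  rw [antisym_apply]
  refine sum_involution (fun w _ => w * swap a b) (fun w _ => ?_) (fun w _ _ => ?_)
    (fun _ _ => mem_univ _) fun w _ => mul_swap_mul_self a b w
  · rw [Perm.sign_mul, Perm.sign_swap hab, Perm.coe_mul, ← rename_rename, hp, mul_neg_one,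
      Units.neg_smul, add_neg_cancel]
  · rw [Ne, mul_eq_left, swap_eq_one_iff]
    exact hab

/-- Each monomial of `p` has equal exponents at two variables on the same side of `P`, hence its
product with `s` is fixed by a transposition. -/
theorem antisym_mul_eq_zero (P : σ → Prop) [DecidablePred P] {s p : MvPolynomial σ R} {d : ℕ}
    (hs : ∀ w : Perm σ, (∀ a, P (w a) ↔ P a) → rename w s = s) (hp : p.IsHomogeneous d)
    (hd : d < ∑ j ∈ range #{a | P a}, j + ∑ j ∈ range #{a | ¬P a}, j) :
    antisym R σ (s * p) = 0 := by
  rw [p.as_sum, mul_sum, map_sum]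
  refine sum_eq_zero fun e he => ?_
  have hdegree : e.degree = d :=
    not_imp_comm.1 hp.coeff_eq_zero (mem_support_iff.1 he)
  obtain ⟨a, b, hab, hP, heq⟩ := exists_eq_of_degree_lt P (hdegree.trans_lt hd)
  refine antisym_eq_zero_of_rename_swap hab ?_
  rw [map_mul, hs _ (swap_preserves hP), rename_swap_monomial heq]

theorem antisym_prod_neg_X_pow (e : σ → ℕ) :
    antisym R σ (∏ i, (-X i) ^ e i) =
      (Matrix.of fun i j : σ => (-X i : MvPolynomial σ R) ^ e j).det := by
  rw [antisym_apply, Matrix.det_apply]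
  simp

end Antisymmetrization

section PairProducts

open MvPolynomial

variable {R σ : Type*} [CommRing R] (q : R)

/-- The product of the factors `q x_a - x_b` over a set of pairs `(a, b)`. -/
def pairProd (P : Finset (σ × σ)) : MvPolynomial σ R :=
  ∏ p ∈ P, (C q * X p.1 - X p.2)

theorem isHomogeneous_C_mul_X_sub_X (a b : σ) :
    (C q * X a - X b : MvPolynomial σ R).IsHomogeneous 1 :=
  (isHomogeneous_C_mul_X q a).sub (isHomogeneous_X R b)

theorem isHomogeneous_pairProd (P : Finset (σ × σ)) : (pairProd q P).IsHomogeneous #P := by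
  rw [card_eq_sum_ones]
  exact IsHomogeneous.prod _ _ _ fun p _ => isHomogeneous_C_mul_X_sub_X q p.1 p.2

theorem rename_pairProd {P : Finset (σ × σ)} (w : Equiv.Perm σ)
    (hw : ∀ p, p ∈ P ↔ (w p.1, w p.2) ∈ P) : rename w (pairProd q P) = pairProd q P := by
  rw [pairProd, map_prod]
  exact prod_equiv (Equiv.prodCongr w w) hw fun p _ => by simp

theorem pairProd_union [DecidableEq σ] {P Q : Finset (σ × σ)} (h : Disjoint P Q) :
    pairProd q (P ∪ Q) = pairProd q P * pairProd q Q :=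
  prod_union h

theorem pairProd_ne_zero [IsDomain R] {P : Finset (σ × σ)} (hP : ∀ p ∈ P, p.1 ≠ p.2) :
    pairProd q P ≠ 0 := by
  refine prod_ne_zero_iff.2 fun p hp h => ?_
  have := congrArg (coeff (Finsupp.single p.2 1)) h
  classical
  simp [coeff_C_mul, coeff_X, Finsupp.single_left_inj, hP p hp] at this

/-- The pairs `(a, b)` of indices in `[l, h)` such that `a + d ≤ b`. -/
def gapPairs (n d l h : ℕ) : Finset (Fin n × Fin n) :=
  {p | l ≤ (p.1 : ℕ) ∧ (p.1 : ℕ) + d ≤ p.2 ∧ (p.2 : ℕ) < h}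

theorem mem_gapPairs {n d l h : ℕ} {p : Fin n × Fin n} :
    p ∈ gapPairs n d l h ↔ l ≤ (p.1 : ℕ) ∧ (p.1 : ℕ) + d ≤ p.2 ∧ (p.2 : ℕ) < h := by
  simp [gapPairs]

theorem card_gapPairs {n h : ℕ} (hh : h ≤ n) (d l : ℕ) :
    #(gapPairs n d l h) = ∑ c ∈ range (h - l), (c + 1 - d) := by
  calc #(gapPairs n d l h) = #((Ico l h).sigma fun b => Ico l (b + 1 - d)) := by
        refine card_bij (fun p _ => ⟨p.2, p.1⟩) (fun p hp => ?_) (fun p _ p' _ h => ?_) ?_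
        · rw [mem_gapPairs] at hp
          simp only [mem_sigma, mem_Ico]
          omega
        · simp only [Sigma.mk.injEq, heq_eq_eq] at h
          exact Prod.ext (Fin.ext h.2) (Fin.ext h.1)
        · rintro ⟨b, a⟩ hab
          simp only [mem_sigma, mem_Ico] at hab
          exact ⟨⟨⟨a, by omega⟩, ⟨b, by omega⟩⟩, mem_gapPairs.2 (by simp only; omega), rfl⟩
    _ = ∑ b ∈ Ico l h, (b + 1 - d - l) := by simp
    _ = ∑ c ∈ range (h - l), (c + 1 - d) := by
        rw [sum_Ico_eq_sum_range]
        exact sum_congr rfl fun c _ => by omega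

theorem card_gapPairs_two_add {n h : ℕ} (hh : h ≤ n) (l : ℕ) :
    #(gapPairs n 2 l h) + (h - l - 1) = ∑ c ∈ range (h - l), c := by
  rw [card_gapPairs hh]
  induction h - l with
  | zero => rfl
  | succ m ih =>
    rw [sum_range_succ, sum_range_succ]
    omega

theorem pairProd_gapPairs_two_mul {n : ℕ} {a b : Fin n} (hab : (b : ℕ) = a + 1) :
    pairProd q (gapPairs n 2 0 n) * (C q * X a - X b) =
      pairProd q {p : Fin n × Fin n | (p.1 : ℕ) < b ∧ ¬ (p.2 : ℕ) < b} *
        (pairProd q (gapPairs n 2 0 b) * pairProd q (gapPairs n 2 b n)) := by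
  have hnotMem : (a, b) ∉ gapPairs n 2 0 n := fun h => by
    simp only [mem_gapPairs] at h
    omega
  have hblocks : Disjoint (gapPairs n 2 0 b) (gapPairs n 2 b n) :=
    disjoint_filter.2 fun p _ h => by omega
  have hcross : Disjoint ({p | (p.1 : ℕ) < b ∧ ¬ (p.2 : ℕ) < b} : Finset (Fin n × Fin n))
      (gapPairs n 2 0 b ∪ gapPairs n 2 b n) := by
    rw [gapPairs, gapPairs, ← filter_or, disjoint_filter]
    intro p _ h
    omega
  rw [← pairProd_union q hblocks, ← pairProd_union q hcross, mul_comm, pairProd,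
    ← prod_insert (f := fun p => C q * X p.1 - X p.2) hnotMem, pairProd]
  congr 1
  ext ⟨c, d⟩
  simp only [mem_gapPairs, mem_insert, mem_union, mem_filter, mem_univ, true_and, Prod.mk.injEq,
    Fin.ext_iff]
  omega

end PairProducts

/-! ### The numerator of the `q`-divided symmetrization -/

section Numerator

open MvPolynomial

variable {R : Type*} [CommRing R] (q : R)

/-- The antisymmetrization of `f · ∏_{i + 2 ≤ j} (q x_i - x_j)`; dividing it by the Vandermonde
product gives the `q`-divided symmetrization of `f`. -/
def qDSNumerator (n : ℕ) : MvPolynomial (Fin n) R →ₗ[R] MvPolynomial (Fin n) R :=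
  antisym R (Fin n) ∘ₗ LinearMap.mulLeft R (pairProd q (gapPairs n 2 0 n))

theorem qDSNumerator_apply {n : ℕ} (f : MvPolynomial (Fin n) R) :
    qDSNumerator q n f = antisym R (Fin n) (pairProd q (gapPairs n 2 0 n) * f) :=
  rfl

variable (R) in
/-- The partial sum `x_1 + ⋯ + x_j` (all variables if `n ≤ j`). -/
def initSum (n j : ℕ) : MvPolynomial (Fin n) R :=
  ∑ a ∈ {a : Fin n | (a : ℕ) < j}, X a

theorem initSum_zero (n : ℕ) : initSum R n 0 = 0 := by
  simp [initSum]

theorem initSum_of_le {n j : ℕ} (h : n ≤ j) : initSum R n j = initSum R n n :=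
  sum_congr (filter_congr fun a _ => by omega) fun _ _ => rfl

theorem fwdDiff_initSum {n : ℕ} (j : Fin n) : fwdDiff 1 (initSum R n) j = X j := by
  have hinsert : ({a : Fin n | (a : ℕ) < j + 1} : Finset (Fin n)) =
      insert j ({a : Fin n | (a : ℕ) < j} : Finset (Fin n)) := by
    ext a
    simp only [mem_insert, mem_filter, mem_univ, true_and, Fin.ext_iff]
    omega
  rw [fwdDiff, initSum, hinsert, sum_insert (by simp), initSum, add_sub_cancel_right]

theorem isHomogeneous_initSum (n j : ℕ) : (initSum R n j).IsHomogeneous 1 :=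
  .sum _ _ _ fun _ _ => isHomogeneous_X _ _

theorem rename_initSum {n j : ℕ} (w : Equiv.Perm (Fin n))
    (hw : ∀ a : Fin n, (w a : ℕ) < j ↔ (a : ℕ) < j) :
    rename w (initSum R n j) = initSum R n j := by
  rw [initSum, map_sum]
  exact sum_equiv w (by simp [hw]) fun a _ => rename_X w a

theorem qDSNumerator_mul_eq_zero_of_symmetric {n d : ℕ} (hd : d + 1 < n)
    {h s : MvPolynomial (Fin n) R} (hh : h.IsHomogeneous d)
    (hs : ∀ w : Equiv.Perm (Fin n), rename w s = s) : qDSNumerator q n (h * s) = 0 := by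
  rw [qDSNumerator_apply, ← mul_assoc, mul_comm]
  refine antisym_mul_eq_zero (fun _ => True) (fun w _ => hs w)
    ((isHomogeneous_pairProd q _).mul hh) ?_
  have hcard := card_gapPairs_two_add (n := n) le_rfl 0
  simp only [Nat.sub_zero, not_true, filter_false, filter_true, card_univ, Fintype.card_fin,
    card_empty, range_zero, sum_empty, add_zero] at hcard ⊢
  omega

theorem qDSNumerator_eq_zero_of_isHomogeneous {n d : ℕ} (hd : d + 1 < n)
    {h : MvPolynomial (Fin n) R} (hh : h.IsHomogeneous d) : qDSNumerator q n h = 0 := by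
  simpa using qDSNumerator_mul_eq_zero_of_symmetric q hd hh (s := 1) fun _ => map_one _

theorem card_filter_not_val_lt (n b : ℕ) : #{c : Fin n | ¬(c : ℕ) < b} = n - b := by
  rw [filter_not, card_sdiff_of_subset (filter_subset _ _), Fin.card_filter_val_lt, card_univ,
    Fintype.card_fin]
  omega

theorem qDSNumerator_mul_relation {n d : ℕ} (hd : d + 2 < n) {h : MvPolynomial (Fin n) R}
    (hh : h.IsHomogeneous d) {a b : Fin n} (hab : (b : ℕ) = a + 1) :
    qDSNumerator q n (h * (initSum R n b * (C q * X a - X b))) = 0 := by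
  have hfactor : pairProd q (gapPairs n 2 0 n) * (h * (initSum R n b * (C q * X a - X b))) =
      (initSum R n b * pairProd q {p : Fin n × Fin n | (p.1 : ℕ) < b ∧ ¬ (p.2 : ℕ) < b}) *
        (pairProd q (gapPairs n 2 0 b) * pairProd q (gapPairs n 2 b n) * h) := by
    linear_combination h * initSum R n b * pairProd_gapPairs_two_mul q hab
  rw [qDSNumerator_apply, hfactor]
  refine antisym_mul_eq_zero (fun c : Fin n => (c : ℕ) < b) (fun w hw => ?_)
    (((isHomogeneous_pairProd q _).mul (isHomogeneous_pairProd q _)).mul hh) ?_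
  · have hblock : ∀ p : Fin n × Fin n,
        p ∈ ({p | (p.1 : ℕ) < b ∧ ¬ (p.2 : ℕ) < b} : Finset (Fin n × Fin n)) ↔
          (w p.1, w p.2) ∈ ({p | (p.1 : ℕ) < b ∧ ¬ (p.2 : ℕ) < b} : Finset (Fin n × Fin n)) := by
      simp only [mem_filter, mem_univ, true_and, hw, implies_true]
    rw [map_mul, rename_initSum w hw, rename_pairProd q w hblock]
  · have hleft := card_gapPairs_two_add (n := n) b.is_lt.le 0
    have hright := card_gapPairs_two_add (n := n) le_rfl (b : ℕ)
    rw [Nat.sub_zero] at hleft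
    rw [card_filter_not_val_lt, Fin.card_filter_val_lt, min_eq_right b.is_lt.le, ← hleft, ← hright]
    have := b.is_lt
    omega

/-- The ideal of the Klyachko relations in `R[x_1, …, x_n]`, where `u_i = x_1 + ⋯ + x_i`. -/
def relationIdeal (n : ℕ) : Ideal (MvPolynomial (Fin n) R) :=
  Ideal.span ({initSum R n n} ∪ {g | ∃ a b : Fin n, (b : ℕ) = a + 1 ∧
    g = initSum R n b * (C q * X a - X b)})

theorem qDSNumerator_homogeneousComponent_mul {n r d : ℕ} {g : MvPolynomial (Fin n) R}
    (hg : g.IsHomogeneous d)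
    (hzero : ∀ (t : ℕ) (h : MvPolynomial (Fin n) R), h.IsHomogeneous t → t + d = r →
      qDSNumerator q n (h * g) = 0) (h : MvPolynomial (Fin n) R) :
    qDSNumerator q n (homogeneousComponent r (h * g)) = 0 := by
  rw [← h.sum_homogeneousComponent, sum_mul, map_sum, map_sum]
  refine sum_eq_zero fun t _ => ?_
  have ht := h.homogeneousComponent_isHomogeneous t
  rw [homogeneousComponent_of_mem ((mem_homogeneousSubmodule _ _).2 (ht.mul hg))]
  split_ifs with hr
  · exact hzero t _ ht hr.symm
  · exact map_zero _

theorem qDSNumerator_homogeneousComponent_eq_zero {r : ℕ} {f : MvPolynomial (Fin (r + 1)) R}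
    (hf : f ∈ relationIdeal q (r + 1)) :
    qDSNumerator q (r + 1) (homogeneousComponent r f) = 0 := by
  refine Submodule.closure_induction (by simp) (fun x y _ _ hx hy => by simp [hx, hy])
    (fun h g hg => ?_) hf
  rcases hg with rfl | ⟨a, b, hab, rfl⟩
  · exact qDSNumerator_homogeneousComponent_mul q (isHomogeneous_initSum _ _)
      (fun t h hh ht => qDSNumerator_mul_eq_zero_of_symmetric q (by omega) hh
        fun w => rename_initSum w fun a => by simp only [Fin.is_lt]) h
  · exact qDSNumerator_homogeneousComponent_mul q
      ((isHomogeneous_initSum _ _).mul (isHomogeneous_C_mul_X_sub_X q a b))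
      (fun t h hh ht => qDSNumerator_mul_relation q (by omega) hh hab) h

theorem qDSNumerator_eq_zero_of_mem_relationIdeal {r : ℕ} {f : MvPolynomial (Fin (r + 1)) R}
    (hf : f ∈ relationIdeal q (r + 1)) (hd : f.totalDegree ≤ r) :
    qDSNumerator q (r + 1) f = 0 := by
  rw [← f.sum_homogeneousComponent, map_sum]
  refine sum_eq_zero fun d hd' => ?_
  rcases ((Nat.lt_succ_iff.1 (mem_range.1 hd')).trans hd).lt_or_eq with hlt | rfl
  · exact qDSNumerator_eq_zero_of_isHomogeneous q (by omega)
      (f.homogeneousComponent_isHomogeneous d)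
  · exact qDSNumerator_homogeneousComponent_eq_zero q hf

end Numerator

section RationalFunctions

open MvPolynomial

/-- The Vandermonde product `∏_{i < j} (x_i - x_j)`. -/
def vandermondeProd (R : Type*) [CommRing R] (n : ℕ) : MvPolynomial (Fin n) R :=
  ∏ i : Fin n, ∏ j ∈ Ioi i, (X i - X j)

variable {k : Type*} [Field k]

variable (k) in
theorem vandermondeProd_ne_zero (n : ℕ) : vandermondeProd k n ≠ 0 :=
  prod_ne_zero_iff.2 fun _ _ => prod_ne_zero_iff.2 fun _ hj =>
    sub_ne_zero.2 <| X_injective.ne (mem_Ioi.1 hj).ne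

theorem permAct_algebraMap {n : ℕ} (w : Equiv.Perm (Fin n)) (p : MvPolynomial (Fin n) k) :
    permAct k w (algebraMap _ _ p) = algebraMap _ _ (rename w p) :=
  IsFractionRing.ringEquivOfRingEquiv_algebraMap _ _

theorem algebraMap_C_mul_X_sub_X (q : k) {n : ℕ} (i j : Fin n) :
    algebraMap _ (RatFun k n) (C q * X i - X j) =
      algebraMap k (RatFun k n) q * ratX k i - ratX k j := by
  rw [map_sub, map_mul, ← MvPolynomial.algebraMap_eq, ← IsScalarTower.algebraMap_apply, ratX, ratX]

theorem algebraMap_pairProd (q : k) {n : ℕ} {P : Finset (Fin n × Fin n)}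
    {t : Fin n → Finset (Fin n)}
    (hP : ∀ p, p ∈ P ↔ p.2 ∈ t p.1) :
    algebraMap _ (RatFun k n) (pairProd q P) =
      ∏ i, ∏ j ∈ t i, (algebraMap k (RatFun k n) q * ratX k i - ratX k j) := by
  rw [← prod_finset_product' P univ t (by simpa using hP), pairProd, map_prod]
  exact prod_congr rfl fun p _ => algebraMap_C_mul_X_sub_X q p.1 p.2

theorem partialLongest_algebraMap {n : ℕ} (p : MvPolynomial (Fin n) k) :
    partialLongest (algebraMap _ (RatFun k n) p) =
      algebraMap _ _ (antisym k (Fin n) p) / algebraMap _ _ (vandermondeProd k n) := by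
  simp only [partialLongest, antisym_apply, vandermondeProd, permAct_algebraMap, map_sum, map_prod,
    map_sub, ratX, Units.smul_def, zsmul_eq_mul, map_mul, map_intCast]

theorem qDS_eq_div (q : k) {n : ℕ} (f : MvPolynomial (Fin n) k) :
    qDS q f = algebraMap _ _ (qDSNumerator q n f) / algebraMap _ _ (vandermondeProd k n) := by
  set adj : Finset (Fin n × Fin n) := {p | (p.2 : ℕ) = p.1 + 1} with hadj
  have hunion : gapPairs n 1 0 n = gapPairs n 2 0 n ∪ adj := by
    ext p
    simp only [mem_gapPairs, hadj, mem_union, mem_filter, mem_univ, true_and]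
    omega
  have hdisj : Disjoint (gapPairs n 2 0 n) adj := disjoint_filter.2 fun p _ h => by omega
  have hne : algebraMap _ (RatFun k n) (pairProd q adj) ≠ 0 := by
    refine (map_ne_zero_iff _ (IsFractionRing.injective _ _)).2 (pairProd_ne_zero q fun p hp => ?_)
    rw [hadj, mem_filter] at hp
    exact fun h => by simp [h] at hp
  rw [qDS, squareLongest, ← algebraMap_pairProd q (P := gapPairs n 1 0 n),
    ← algebraMap_pairProd q (P := adj), hunion, pairProd_union q hdisj, map_mul, mul_assoc,
    mul_div_cancel₀ _ hne, ← map_mul, partialLongest_algebraMap, qDSNumerator_apply]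
  · simp [hadj]
  · intro p
    rw [mem_gapPairs, mem_Ioi, Fin.lt_def]
    omega

end RationalFunctions
/-! ### Normalization of the `q`-divided symmetrization -/

section Normalization

open MvPolynomial

/-- The exponent of `x_c` in the term of `∏_{a < b} (q x_a - x_b)` where `q x_a` is chosen for the
pairs `(a, b) ∈ B` and `-x_b` for all others. -/
def choiceExponent {n : ℕ} (B : Finset (Fin n × Fin n)) (c : Fin n) : ℕ :=
  #{p ∈ B | p.1 = c} + #{p ∈ gapPairs n 1 0 n \ B | p.2 = c}

theorem choiceExponent_empty {n : ℕ} (c : Fin n) : choiceExponent ∅ c = c := by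
  have : ({p ∈ gapPairs n 1 0 n | p.2 = c} : Finset _) = Iio c ×ˢ {c} := by
    ext ⟨i, j⟩
    simp only [mem_filter, mem_gapPairs, mem_product, mem_Iio, mem_singleton, Fin.ext_iff,
      Fin.lt_def]
    omega
  simp [choiceExponent, this]

theorem sum_choiceExponent {n : ℕ} {B : Finset (Fin n × Fin n)} (hB : B ⊆ gapPairs n 1 0 n) :
    ∑ c, choiceExponent B c = ∑ j ∈ range n, j := by
  have hcard := card_gapPairs (le_refl n) 1 0
  simp only [Nat.sub_zero, Nat.add_sub_cancel] at hcard
  simp only [choiceExponent]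
  rw [← hcard, ← card_sdiff_add_card_eq_card hB, sum_add_distrib,
    ← card_eq_sum_card_fiberwise (by simp), ← card_eq_sum_card_fiberwise (by simp), add_comm]

theorem lt_choiceExponent {n : ℕ} {B : Finset (Fin n × Fin n)} (hB : B ⊆ gapPairs n 2 0 n)
    {a b c : Fin n} (hab : (a, b) ∈ B) (hmin : ∀ p ∈ B, a ≤ p.1) (hac : a ≤ c) :
    (a : ℕ) < choiceExponent B c := by
  set L : Finset (Fin n × Fin n) := Iio a ×ˢ {c} with hL
  have hcard : #L = a := by simp [hL]
  have hsub : L ⊆ ({p ∈ gapPairs n 1 0 n \ B | p.2 = c} : Finset _) := by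
    rintro ⟨i, j⟩ h
    simp only [hL, mem_product, mem_Iio, mem_singleton] at h
    obtain ⟨hia, rfl⟩ := h
    have hB : (i, j) ∉ B := fun hp => (hmin _ hp).not_gt hia
    simp only [mem_filter, mem_sdiff, mem_gapPairs, hB, not_false_eq_true, and_true]
    exact ⟨Nat.zero_le _, hia.trans_le hac, j.is_lt⟩
  rcases hac.eq_or_lt with rfl | hlt
  · have hpos : 0 < #{p ∈ B | p.1 = a} := card_pos.2 ⟨(a, b), by simp [hab]⟩
    have := card_le_card hsub
    rw [choiceExponent]
    omega
  · -- The pair `(c - 1, c)` is adjacent, so it does not belong to `B`.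
    have hssub : L ⊂ ({p ∈ gapPairs n 1 0 n \ B | p.2 = c} : Finset _) := by
      rw [Fin.lt_def] at hlt
      refine (ssubset_iff_of_subset hsub).2 ⟨(⟨c - 1, by omega⟩, c), ?_, fun h => ?_⟩
      · have hB : ((⟨c - 1, by omega⟩, c) : Fin n × Fin n) ∉ B := fun hp => by
          have := mem_gapPairs.1 (hB hp)
          simp only at this
          omega
        simp only [mem_filter, mem_sdiff, mem_gapPairs, hB, not_false_eq_true, and_true]
        omega
      · simp only [hL, mem_product, mem_Iio, Fin.lt_def] at h
        omega
    have := card_lt_card hssub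
    rw [choiceExponent]
    omega

theorem not_injective_choiceExponent {n : ℕ} {B : Finset (Fin n × Fin n)}
    (hB : B ⊆ gapPairs n 2 0 n) (hne : B.Nonempty) :
    ¬ Function.Injective (choiceExponent B) := by
  intro hinj
  obtain ⟨⟨a, b⟩, hab, hmin⟩ := exists_min_image B Prod.fst hne
  have hsmall := sum_range_card_le_sum_of_injOn
    (hinj.injOn (s := ({c | (c : ℕ) < a} : Finset (Fin n))))
  have hlarge := sum_range_card_add_le_sum_of_injOn (c := a + 1)
    (hinj.injOn (s := ({c | ¬(c : ℕ) < a} : Finset (Fin n)))) fun c hc =>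
      lt_choiceExponent hB hab hmin (Fin.le_def.2 (by simpa using hc))
  have hsum := sum_choiceExponent (hB.trans fun p hp => by rw [mem_gapPairs] at hp ⊢; omega)
  have hrange : ∑ j ∈ range n, j = ∑ j ∈ range a, j + ∑ j ∈ range (n - a), (a + j) := by
    rw [← sum_range_add, Nat.add_sub_cancel' a.is_lt.le]
  rw [← sum_filter_add_sum_filter_not univ fun c : Fin n => (c : ℕ) < a, hrange] at hsum
  rw [card_filter_not_val_lt] at hlarge
  rw [Fin.card_filter_val_lt, min_eq_right a.is_lt.le] at hsmall
  simp only [add_right_comm, sum_add_distrib, sum_const, card_range, smul_eq_mul, mul_one]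
    at hlarge hsum
  have := a.is_lt
  omega

variable {R : Type*} [CommRing R]

theorem prod_choice (q : R) {n : ℕ} (B : Finset (Fin n × Fin n)) :
    (∏ p ∈ B, C q * X p.1) * ∏ p ∈ gapPairs n 1 0 n \ B, -X p.2 =
      C ((-q) ^ #B) * ∏ c, (-X c : MvPolynomial (Fin n) R) ^ choiceExponent B c := by
  have hB : ∏ p ∈ B, C q * X p.1 =
      C ((-q) ^ #B) * ∏ p ∈ B, (-X p.1 : MvPolynomial (Fin n) R) := by
    rw [map_pow, ← prod_const, ← prod_mul_distrib]
    simp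
  simp only [hB, choiceExponent, pow_add, prod_mul_distrib, mul_assoc, ← prod_const]
  rw [prod_fiberwise' B Prod.fst fun c => (-X c : MvPolynomial (Fin n) R),
    prod_fiberwise' _ Prod.snd fun c => (-X c : MvPolynomial (Fin n) R)]

theorem antisym_prod_choiceExponent_empty (n : ℕ) :
    antisym R (Fin n) (∏ c, (-X c) ^ choiceExponent ∅ c) = vandermondeProd R n := by
  have : (Matrix.of fun i j : Fin n => (-X i : MvPolynomial (Fin n) R) ^ choiceExponent ∅ j) =
      Matrix.vandermonde fun i => -X i := by
    ext1 i j
    simp [choiceExponent_empty]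
  rw [antisym_prod_neg_X_pow, this, Matrix.det_vandermonde, vandermondeProd]
  simp only [neg_sub_neg]

theorem antisym_prod_choiceExponent {n : ℕ} {B : Finset (Fin n × Fin n)}
    (hB : B ⊆ gapPairs n 2 0 n) (hne : B.Nonempty) :
    antisym R (Fin n) (∏ c, (-X c) ^ choiceExponent B c) = 0 := by
  obtain ⟨c, d, hcd, hne⟩ := Function.not_injective_iff.1 (not_injective_choiceExponent hB hne)
  rw [antisym_prod_neg_X_pow]
  exact Matrix.det_zero_of_column_eq hne fun i => by simp [hcd]

theorem prod_neg_X_succ (r : ℕ) :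
    ∏ i : Fin r, (-X i.succ : MvPolynomial (Fin (r + 1)) R) =
      ∏ p ∈ gapPairs (r + 1) 1 0 (r + 1) \ gapPairs (r + 1) 2 0 (r + 1), -X p.2 := by
  refine prod_nbij (fun i => (i.castSucc, i.succ)) ?_ ?_ ?_ fun _ _ => rfl
  · intro i _
    simp [mem_gapPairs]
  · exact fun i _ j _ h => Fin.succ_injective r (Prod.mk.inj h).2
  · rintro ⟨i, j⟩ h
    simp only [coe_sdiff, Set.mem_sdiff, mem_coe, mem_gapPairs] at h
    exact ⟨⟨i, by omega⟩, mem_univ _, Prod.ext (Fin.ext (by simp)) (Fin.ext (by simp; omega))⟩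

/-- Expand the product `∏_{i + 2 ≤ j} (q x_i - x_j)`: only the term without any `q` survives. -/
theorem qDSNumerator_prod_neg_X_succ (q : R) (r : ℕ) :
    qDSNumerator q (r + 1) (∏ i : Fin r, -X i.succ) = vandermondeProd R (r + 1) := by
  set F := gapPairs (r + 1) 2 0 (r + 1) with hF
  set A := gapPairs (r + 1) 1 0 (r + 1) with hA
  have hFA : F ⊆ A := fun p hp => by
    rw [hF, mem_gapPairs] at hp
    rw [hA, mem_gapPairs]
    omega
  have hexpand : pairProd q F * ∏ i : Fin r, -X i.succ = ∑ B ∈ F.powerset,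
      C ((-q) ^ #B) * ∏ c, (-X c : MvPolynomial (Fin (r + 1)) R) ^ choiceExponent B c := by
    simp only [pairProd, sub_eq_add_neg, prod_add, sum_mul]
    refine sum_congr rfl fun B hB => ?_
    have hBF := mem_powerset.1 hB
    rw [mul_assoc, prod_neg_X_succ, ← prod_choice, ← hA, ← hF,
      ← prod_union (disjoint_sdiff.mono_left sdiff_subset), union_comm,
      sdiff_union_sdiff_cancel hFA hBF]
  rw [qDSNumerator_apply, hexpand, map_sum, sum_eq_single_of_mem ∅ (empty_mem_powerset F)]
  · simp [antisym_prod_choiceExponent_empty]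
  · intro B hB hne
    rw [← smul_eq_C_mul, map_smul,
      antisym_prod_choiceExponent (mem_powerset.1 hB) (nonempty_iff_ne_empty.2 hne), smul_zero]

end Normalization
/-! ### The quotient by the Klyachko relations -/

section RelationQuotient

open MvPolynomial

variable {k : Type*} [Field k] {q : k}

theorem IsKlyachkoSeq.aeval_eq_zero_of_mem_qsymIdeal {A : Type*} [CommRing A] [Algebra k A]
    {v : ℕ → A} (hq : ∀ n, 0 < n → qInt q n ≠ 0) (hv : IsKlyachkoSeq (algebraMap k A q) v)
    (h0 : v 0 = 0) {n : ℕ} (hn : v n = 0) {f : MvPolynomial (Fin n) k} (hf : f ∈ qsymIdeal k n) :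
    aeval (fun i : Fin n => fwdDiff 1 v i) f = 0 := by
  suffices qsymIdeal k n ≤ RingHom.ker (aeval (R := k) fun i : Fin n => fwdDiff 1 v i) from this hf
  refine Ideal.span_le.2 fun p ⟨hp, hp0⟩ => ?_
  rw [SetLike.mem_coe, RingHom.mem_ker, ← p.sum_homogeneousComponent, map_sum]
  refine sum_eq_zero fun d _ => ?_
  rcases d.eq_zero_or_pos with rfl | hd
  · rw [homogeneousComponent_zero, ← constantCoeff_eq, hp0, map_zero, map_zero]
  obtain ⟨c, hc⟩ :=
    (hp.homogeneousComponent d).exists_eq_sum (p.homogeneousComponent_isHomogeneous d)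
  rw [hc, map_sum]
  refine sum_eq_zero fun T _ => ?_
  have hpos := numParts_pos T hd
  rw [map_smul, aeval_fundamentalOfSet, hv.fundamentalEval_eq_zero_of_ne (qFactorial_ne_zero hq d)
    h0 hn T (by omega) (by have := numParts_le T d; omega), smul_zero]

/-- The class of `x_1 + ⋯ + x_j` modulo the Klyachko relations, playing the role of `u_j`. -/
def relationSeq (q : k) (n j : ℕ) : MvPolynomial (Fin n) k ⧸ relationIdeal q n :=
  Ideal.Quotient.mk _ (initSum k n j)

theorem relationSeq_zero (n : ℕ) : relationSeq q n 0 = 0 := by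
  rw [relationSeq, initSum_zero, map_zero]

theorem relationSeq_of_le {n j : ℕ} (h : n ≤ j) : relationSeq q n j = 0 := by
  rw [relationSeq, initSum_of_le h]
  exact Ideal.Quotient.eq_zero_iff_mem.2 (Ideal.subset_span (.inl rfl))

theorem fwdDiff_relationSeq {n : ℕ} (i : Fin n) :
    fwdDiff 1 (relationSeq q n) i = Ideal.Quotient.mk _ (X i) := by
  rw [← fwdDiff_initSum, fwdDiff, fwdDiff, map_sub, relationSeq, relationSeq]

theorem isKlyachkoSeq_relationSeq (q : k) (n : ℕ) :
    IsKlyachkoSeq (algebraMap k _ q) (relationSeq q n) := fun j => by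
  rcases lt_or_ge (j + 1) n with hj | hj
  · let a : Fin n := ⟨j, by omega⟩
    let b : Fin n := ⟨j + 1, hj⟩
    have hrel : relationSeq q n b * (algebraMap k _ q * fwdDiff 1 (relationSeq q n) a -
        fwdDiff 1 (relationSeq q n) b) = 0 := by
      rw [fwdDiff_relationSeq, fwdDiff_relationSeq]
      exact Ideal.Quotient.eq_zero_iff_mem.2 (Ideal.subset_span (.inr ⟨a, b, rfl, rfl⟩))
    linear_combination -hrel
  · simp only [relationSeq_of_le hj, zero_mul, mul_zero]

theorem mk_rename_castLE {n m : ℕ} (hm : m ≤ n) (p : MvPolynomial (Fin m) k) :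
    Ideal.Quotient.mk (relationIdeal q n) (rename (Fin.castLE hm) p) =
      aeval (fun i : Fin m => fwdDiff 1 (relationSeq q n) i) p := by
  have hX (i : Fin m) : fwdDiff 1 (relationSeq q n) i =
      Ideal.Quotient.mk (relationIdeal q n) (rename (Fin.castLE hm) (X i)) := by
    rw [rename_X, ← fwdDiff_relationSeq, Fin.val_castLE]
  simp only [hX]
  exact DFunLike.congr_fun (aeval_unique ((Ideal.Quotient.mkₐ k _).comp (rename _))) p

theorem qsymIdeal_le_relationIdeal (hq : ∀ n, 0 < n → qInt q n ≠ 0) (n : ℕ) :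
    qsymIdeal k n ≤ relationIdeal q n := fun f hf => by
  have h := (isKlyachkoSeq_relationSeq q n).aeval_eq_zero_of_mem_qsymIdeal hq (relationSeq_zero n)
    (relationSeq_of_le le_rfl) hf
  rw [← mk_rename_castLE le_rfl, Ideal.Quotient.eq_zero_iff_mem] at h
  simpa using h

theorem qDS_eq_zero_of_mem_qsymIdeal (hq : ∀ n, 0 < n → qInt q n ≠ 0) {r : ℕ}
    {f : MvPolynomial (Fin (r + 1)) k} (hf : f ∈ qsymIdeal k (r + 1)) (hd : f.totalDegree ≤ r) :
    qDS q f = 0 := by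
  rw [qDS_eq_div, qDSNumerator_eq_zero_of_mem_relationIdeal q
    (qsymIdeal_le_relationIdeal hq _ hf) hd, map_zero, zero_div]

theorem qDS_eq_algebraMap {r : ℕ} {f : MvPolynomial (Fin (r + 1)) k} {c : k}
    (hd : f.totalDegree ≤ r)
    (hf : f - c • ∏ i : Fin r, -X i.succ ∈ relationIdeal q (r + 1)) :
    qDS q f = algebraMap k _ c := by
  have hbase : (c • ∏ i : Fin r, -X i.succ : MvPolynomial (Fin (r + 1)) k).totalDegree ≤ r := by
    refine (totalDegree_smul_le _ _).trans ((totalDegree_finsetProd _ _).trans ?_)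
    simp
  have hnum := qDSNumerator_eq_zero_of_mem_relationIdeal q hf
    ((totalDegree_sub _ _).trans (max_le hd hbase))
  rw [map_sub, map_smul, qDSNumerator_prod_neg_X_succ, sub_eq_zero] at hnum
  have hvdm : algebraMap _ (RatFun k (r + 1)) (vandermondeProd k (r + 1)) ≠ 0 :=
    (map_ne_zero_iff _ (IsFractionRing.injective _ _)).2 (vandermondeProd_ne_zero k _)
  rw [qDS_eq_div, hnum, smul_eq_C_mul, map_mul, mul_div_cancel_right₀ _ hvdm,
    ← MvPolynomial.algebraMap_eq, ← IsScalarTower.algebraMap_apply]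

theorem mk_prod_neg_X_succ {r : ℕ} (hr : qFactorial q r ≠ 0) :
    Ideal.Quotient.mk (relationIdeal q (r + 1)) (∏ i : Fin r, -X i.succ) =
      (1 / qFactorial q r) • ∏ i ∈ range r, relationSeq q (r + 1) (i + 1) := by
  rw [← (isKlyachkoSeq_relationSeq q (r + 1)).prod_neg_fwdDiff_eq_smul hr
    (relationSeq_of_le le_rfl), ← Fin.prod_univ_eq_prod_range, map_prod]
  exact prod_congr rfl fun i _ => by rw [map_neg, ← fwdDiff_relationSeq, Fin.val_succ]

theorem qDS_rename_fundamentalOfSet {r : ℕ} (hq : qFactorial q r ≠ 0) (hr : 0 < r)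
    (S : Finset ℕ) {m : ℕ} (hm : m ≤ r + 1) :
    qDS q (rename (Fin.castLE hm) (fundamentalOfSet k S r m)) =
      algebraMap k _ (if m = numParts S r then q ^ descStat S r else 0) := by
  have hv := isKlyachkoSeq_relationSeq q (r + 1)
  refine qDS_eq_algebraMap ((totalDegree_rename_le _ _).trans
    (isHomogeneous_fundamentalOfSet k S r m).totalDegree_le) ?_
  rw [← Ideal.Quotient.eq, mk_rename_castLE, aeval_fundamentalOfSet]
  split_ifs with h
  · have hval := hv.fundamentalEval_eq_smul hq (relationSeq_zero _) S 0
    simp only [zero_add, ← h] at hval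
    rw [hval, ← Ideal.Quotient.mkₐ_eq_mk k, map_smul, Ideal.Quotient.mkₐ_eq_mk,
      mk_prod_neg_X_succ hq, smul_smul, mul_one_div]
  · rw [zero_smul, map_zero]
    rcases lt_or_gt_of_ne h with hlt | hgt
    · exact fundamentalEval_eq_zero S _ hlt
    · have := numParts_pos S hr
      exact hv.fundamentalEval_eq_zero_of_ne hq (relationSeq_zero _) (relationSeq_of_le le_rfl) S
        (by omega) (by omega)

theorem qDS_sum_smul {ι : Type*} (s : Finset ι) (c : ι → k) {n : ℕ}
    (p : ι → MvPolynomial (Fin n) k) :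
    qDS q (∑ i ∈ s, c i • p i) = ∑ i ∈ s, algebraMap k _ (c i) * qDS q (p i) := by
  simp only [qDS_eq_div, map_sum, sum_div, map_smul]
  simp only [smul_eq_C_mul, map_mul, mul_div_assoc, ← MvPolynomial.algebraMap_eq,
    ← IsScalarTower.algebraMap_apply]

end RelationQuotient

/-! ### The Klyachko algebras -/

section KlyachkoAlgebras

variable {k : Type*} [Field k] {q : k}

theorem u_eq_zero {I : Set ℤ} {i : ℤ} (hi : i ∉ I) : u q I i = 0 :=
  Ideal.Quotient.eq_zero_iff_mem.2 (Ideal.mem_sup_right (Ideal.subset_span ⟨i, hi, rfl⟩))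

theorem isKlyachkoSeq_u (q : k) (I : Set ℤ) :
    IsKlyachkoSeq (algebraMap k (Klyachko q I) q) fun j => u q I j := fun j => by
  have hrel : algebraMap k _ (q + 1) * u q I (j + 1) ^ 2 -
      algebraMap k _ q * u q I (j + 1) * u q I (j + 1 - 1) -
        u q I (j + 1) * u q I (j + 1 + 1) = 0 :=
    Ideal.Quotient.eq_zero_iff_mem.2 (Ideal.mem_sup_left (Ideal.subset_span ⟨(j : ℤ) + 1, rfl⟩))
  rw [add_sub_cancel_right, map_add, map_one] at hrel
  simp only [fwdDiff]
  push_cast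
  linear_combination -hrel

theorem rhoFin_eq_zero (hq : ∀ n, 0 < n → qInt q n ≠ 0) {n : ℕ} {f : MvPolynomial (Fin n) k}
    (hf : f ∈ qsymIdeal k n) : rhoFin q n f = 0 := by
  have h := (isKlyachkoSeq_u q (Set.Ioo 0 (n : ℤ))).aeval_eq_zero_of_mem_qsymIdeal hq
    (u_eq_zero (by simp)) (u_eq_zero (by simp)) hf
  simpa only [rhoFin, fwdDiff, Nat.cast_add, Nat.cast_one] using h

theorem prod_Icc_eq_prod_range {M : Type*} [CommMonoid M] (g : ℤ → M) (s r : ℕ) :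
    ∏ i ∈ Icc (1 + (s : ℤ)) (r + s), g i = ∏ i ∈ range r, g ((s + i + 1 : ℕ) : ℤ) := by
  refine (prod_nbij' (fun i => ((s + i + 1 : ℕ) : ℤ)) (fun i => (i - 1 - s).toNat) ?_ ?_ ?_ ?_
    fun _ _ => rfl).symm <;> simp only [mem_range, mem_Icc] <;> omega

theorem rhoPos_rename_fundamental {r : ℕ} (hq : qFactorial q r ≠ 0) (α : Composition r) {m : ℕ}
    (hm : α.length ≤ m) :
    rhoPos q (MvPolynomial.rename Fin.val (fundamental k α m)) =
      (q ^ nStat α / qFactorial q r) •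
        ∏ i ∈ Icc (1 + ((m : ℤ) - α.length)) (r + ((m : ℤ) - α.length)),
          u q (Set.Ioi 0) i := by
  obtain ⟨s, rfl⟩ := Nat.exists_eq_add_of_le' hm
  have h := (isKlyachkoSeq_u q (Set.Ioi 0)).fundamentalEval_eq_smul hq (u_eq_zero (by simp))
    (partialSums α) s
  rw [numParts_partialSums, descStat_partialSums] at h
  rw [Nat.cast_add, add_sub_cancel_right, prod_Icc_eq_prod_range, ← h,
    fundamental_eq_fundamentalOfSet, ← aeval_fundamentalOfSet k, rhoPos, MvPolynomial.aeval_rename]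
  simp only [Function.comp_def, fwdDiff, Nat.cast_add, Nat.cast_one]

end KlyachkoAlgebras

/-! ### Quasisymmetric functions -/

section QuasisymmetricFunctions

variable {k : Type*} [Field k] (q : k)

theorem IsQuasisymmetric.truncate_mem_qsymIdeal {f : MvPowerSeries ℕ k} (hf : IsQuasisymmetric f)
    {r : ℕ} (hfr : f.IsHomogeneous r) (hr : 0 < r) (m : ℕ) : truncate f m ∈ qsymIdeal k m := by
  refine Ideal.subset_span ⟨isQuasisymmetricPoly_truncate hf m, ?_⟩
  rw [MvPolynomial.constantCoeff_eq]
  exact (isHomogeneous_truncate hf hfr m).coeff_eq_zero (by simpa using hr.ne)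

theorem mk_eval_eq_mul_inv_qPochhammer {p : ∀ m, MvPolynomial (Fin m) k} {r : ℕ} (hr : 0 < r)
    (hq : qFactorial q r ≠ 0) {s : Finset (Finset ℕ)} {c : Finset ℕ → k}
    (hc : ∀ m, p m = ∑ S ∈ s, c S • fundamentalOfSet k S r m) :
    PowerSeries.mk (fun j : ℕ => if 1 ≤ j then
        MvPolynomial.eval (fun i : Fin j => q ^ (i : ℕ)) (p j) else 0) =
      (∑ m ∈ range (r + 2), PowerSeries.C
        (∑ S ∈ s, c S * if m = numParts S r then q ^ descStat S r else 0) * PowerSeries.X ^ m) *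
        (qPochhammer q (r + 1))⁻¹ := by
  rw [PowerSeries.eq_mul_inv_iff_mul_eq (by simp [qPochhammer])]
  have hmk : PowerSeries.mk (fun j : ℕ => if 1 ≤ j then
      MvPolynomial.eval (fun i : Fin j => q ^ (i : ℕ)) (p j) else 0) =
      ∑ S ∈ s, PowerSeries.C (c S) *
        PowerSeries.mk (fundamentalEval (fun j => q ^ j) S r) := by
    ext j
    rw [PowerSeries.coeff_mk, map_sum]
    simp only [PowerSeries.coeff_C_mul, PowerSeries.coeff_mk]
    split_ifs with hj
    · rw [hc, map_sum]
      refine sum_congr rfl fun S _ => ?_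
      rw [MvPolynomial.smul_eval, ← MvPolynomial.coe_aeval_eq_eval, RingHom.coe_coe,
        aeval_fundamentalOfSet k fun j => q ^ j]
    · refine (sum_eq_zero fun S _ => ?_).symm
      have := numParts_pos S hr
      rw [fundamentalEval_eq_zero S _ (by omega), mul_zero]
  simp only [hmk, map_sum, sum_mul]
  rw [sum_comm]
  refine sum_congr rfl fun S _ => ?_
  have hle := numParts_le S r
  rw [mul_assoc, mk_fundamentalEval_pow_mul_qPochhammer q hq,
    sum_eq_single_of_mem (numParts S r) (mem_range.2 (by omega))]
  · rw [if_pos rfl, map_mul, mul_assoc]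
  · intro m _ hm
    rw [if_neg hm, mul_zero, map_zero, zero_mul]

end QuasisymmetricFunctions

end QKlyachko

end

theorem theorem1p3_general {k : Type*} [Field k] (q : k)
    (hq : ∀ n : ℕ, 0 < n → QKlyachko.qInt q n ≠ 0) (r : ℕ) (hr : 0 < r) :
    (∀ f : MvPowerSeries ℕ k, QKlyachko.IsQuasisymmetric f → f.IsHomogeneous r →
      ∃ c : ℕ → k,
        (∀ (m : ℕ) (hm : m ≤ r + 1),
          QKlyachko.qDS q (MvPolynomial.rename (Fin.castLE hm) (QKlyachko.truncate f m)) =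
            algebraMap k (QKlyachko.RatFun k (r + 1)) (c m)) ∧
        PowerSeries.mk (fun j : ℕ => if 1 ≤ j then
            MvPolynomial.eval (fun i : Fin j => q ^ (i : ℕ)) (QKlyachko.truncate f j) else 0) =
          (∑ m ∈ Finset.range (r + 2), PowerSeries.C (c m) * PowerSeries.X ^ m) *
            (QKlyachko.qPochhammer q (r + 1))⁻¹) ∧
    (∀ f : MvPowerSeries ℕ k, QKlyachko.IsQuasisymmetric f → f.IsHomogeneous r →
      QKlyachko.rhoFin q (r + 1) (QKlyachko.truncate f (r + 1)) = 0) ∧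
    (∀ f ∈ QKlyachko.qsymIdeal k (r + 1), f.totalDegree ≤ r → QKlyachko.qDS q f = 0) ∧
    (∀ (α : Composition r) (m : ℕ), α.length ≤ m →
      QKlyachko.rhoPos q (MvPolynomial.rename Fin.val (QKlyachko.fundamental k α m)) =
        (q ^ QKlyachko.nStat α / QKlyachko.qFactorial q r) •
          ∏ i ∈ Finset.Icc (1 + ((m : ℤ) - α.length)) (r + ((m : ℤ) - α.length)),
            QKlyachko.u q (Set.Ioi 0) i) ∧
    (∀ (α : Composition r) (m : ℕ) (hm : m ≤ r + 1), α.length ≤ m →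
      QKlyachko.qDS q
          (MvPolynomial.rename (Fin.castLE hm) (QKlyachko.fundamental k α m)) =
        if m = α.length then
          algebraMap k (QKlyachko.RatFun k (r + 1)) (q ^ QKlyachko.nStat α) else 0) ∧
    (∀ (n : ℕ), ∀ f ∈ QKlyachko.qsymIdeal k n, QKlyachko.rhoFin q n f = 0) := by
  have hr0 := QKlyachko.qFactorial_ne_zero hq r
  refine ⟨fun f hf hfr => ?_,
    fun f hf hfr => QKlyachko.rhoFin_eq_zero hq (hf.truncate_mem_qsymIdeal hfr hr _),
    fun f hf hd => QKlyachko.qDS_eq_zero_of_mem_qsymIdeal hq hf hd,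
    fun α m hm => QKlyachko.rhoPos_rename_fundamental hr0 α hm, fun α m hm _ => ?_,
    fun n f hf => QKlyachko.rhoFin_eq_zero hq hf⟩
  · obtain ⟨c, hc⟩ := hf.exists_truncate_eq_sum hfr
    refine ⟨fun m => _, fun m hm => ?_, QKlyachko.mk_eval_eq_mul_inv_qPochhammer q hr hr0 hc⟩
    simp only [hc, map_sum, map_smul, QKlyachko.qDS_sum_smul, map_mul,
      QKlyachko.qDS_rename_fundamentalOfSet hr0 hr]
  · rw [QKlyachko.fundamental_eq_fundamentalOfSet, QKlyachko.qDS_rename_fundamentalOfSet hr0 hr,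
      QKlyachko.numParts_partialSums, QKlyachko.descStat_partialSums,
      apply_ite (algebraMap k _), map_zero]

theorem theorem1p3 {k : Type*} [Field k] [CharZero k] (q : k)
    (hq : ∀ n : ℕ, 0 < n → q ^ n = 1 → q = 1) (r : ℕ) (hr : 0 < r) :
    -- (1) the generating function of principal specializations
    (∀ f : MvPowerSeries ℕ k, QKlyachko.IsQuasisymmetric f → f.IsHomogeneous r →
      ∃ c : ℕ → k,
        (∀ (m : ℕ) (hm : m ≤ r + 1),
          QKlyachko.qDS q (MvPolynomial.rename (Fin.castLE hm) (QKlyachko.truncate f m)) =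
            algebraMap k (QKlyachko.RatFun k (r + 1)) (c m)) ∧
        PowerSeries.mk (fun j : ℕ => if 1 ≤ j then
            MvPolynomial.eval (fun i : Fin j => q ^ (i : ℕ)) (QKlyachko.truncate f j) else 0) =
          (∑ m ∈ Finset.range (r + 2), PowerSeries.C (c m) * PowerSeries.X ^ m) *
            (QKlyachko.qPochhammer q (r + 1))⁻¹) ∧
    -- (2) vanishing in `K_{r+1}`
    (∀ f : MvPowerSeries ℕ k, QKlyachko.IsQuasisymmetric f → f.IsHomogeneous r →
      QKlyachko.rhoFin q (r + 1) (QKlyachko.truncate f (r + 1)) = 0) ∧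
    -- (3) vanishing of the `q`-divided symmetrization on the degree `r` part of the ideal
    (∀ f ∈ QKlyachko.qsymIdeal k (r + 1), f.totalDegree ≤ r → QKlyachko.qDS q f = 0) ∧
    -- the image of fundamental quasisymmetric polynomials in `K_+`
    (∀ (α : Composition r) (m : ℕ), α.length ≤ m →
      QKlyachko.rhoPos q (MvPolynomial.rename Fin.val (QKlyachko.fundamental k α m)) =
        (q ^ QKlyachko.nStat α / QKlyachko.qFactorial q r) •
          ∏ i ∈ Finset.Icc (1 + ((m : ℤ) - α.length)) (r + ((m : ℤ) - α.length)),
            QKlyachko.u q (Set.Ioi 0) i) ∧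
    -- the `q`-divided symmetrization of fundamental quasisymmetric polynomials
    (∀ (α : Composition r) (m : ℕ) (hm : m ≤ r + 1), α.length ≤ m →
      QKlyachko.qDS q
          (MvPolynomial.rename (Fin.castLE hm) (QKlyachko.fundamental k α m)) =
        if m = α.length then
          algebraMap k (QKlyachko.RatFun k (r + 1)) (q ^ QKlyachko.nStat α) else 0) ∧
    -- vanishing of `ρ_n` on the whole ideal
    (∀ (n : ℕ), ∀ f ∈ QKlyachko.qsymIdeal k n, QKlyachko.rhoFin q n f = 0) :=
  theorem1p3_general q (fun _ hn => QKlyachko.qInt_ne_zero hq hn) r hr
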